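/- All diagrams are polygonal and lie on the sphere $S^2$ (edges are minor great-circle arcs), are unoriented, and are considered up to subdivision and planar isotopy in addition to the moves named below. A *linkoid diagram* with $n\ge 0$ components is a generic immersion of $n$ closed intervals in $S^2$ whose only singularities are transversal double points, each with over/under information (classical crossings), and whose $2n$ endpoints are distinct from one another and from the double points. The endpoints are labelled bijectively by $E=\{1,\dots,2n\}$; the *strand permutation* $\tau\in S_{2n}$ exchanges the labels of the two ends of each component, and $L_\tau$ denotes the labelled diagram. A *linkoid* is a class of such diagrams under planar isotopy and the three Reidemeister moves $R_1,R_2,R_3$, performed in discs that contain no endpoint (so no strand is moved over or under an endpoint). A *virtual link diagram* is a generic immersion of finitely many circles in $S^2$, each double point of which is either a classical crossing or a virtual crossing (without over/under information). A *virtual link* is a class of such diagrams under planar isotopy and the generalized Reidemeister moves, i.e. $R_1,R_2,R_3$ and the detour move (an arc all of whose crossings are virtual is replaced by any other generic arc with the same ends, all of whose crossings are virtual; this comprises the virtual and the semi-virtual Reidemeister moves). An *invariant of virtual links* is a map on the set of virtual links, with values in any set. A *closure permutation* is any $\sigma\in S_{2n}$ with $\sigma^2=\mathrm{id}$ and $\sigma(i)\ne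 i$ for all $i\in E$. A *virtual closure diagram* of a linkoid diagram $L_\tau$ with respect to $\sigma$ is a virtual link diagram consisting of $L_\tau$, with its crossings, and of one closure arc between the endpoints $i$ and $\sigma(i)$ for every pair $\{i,\sigma(i)\}$, where all crossings on the closure arcs are virtual. **Theorem 4.1.** Let $n\ge 0$, let $\tau,\sigma\in S_{2n}$, where $\sigma$ is a closure permutation, and let $\mathcal F$ be an invariant of virtual links. 1. Every linkoid diagram $L_\tau$ with strand permutation $\tau$ has a virtual closure diagram with respect to $\sigma$. 2. Any two virtual closure diagrams of the same $L_\tau$ with respect to $\sigma$ are equivalent. So they represent one virtual link, denoted $(L_\tau,\sigma)_v$, which does not depend on the choice of the closure arcs. 3. If $L_\tau$ and $L'_\tau$ are equivalent linkoid diagrams, then their virtual closure diagrams with respect to $\sigma$ are equivalent, i.e. $(L_\tau,\sigma)_v=(L'_\tau,\sigma)_v$. 4. Consequently $\mathcal F_\sigma(L_\tau):=\mathcal F((L_\tau,\sigma)_v)$ is an invariant of linkoids: there is exactly one map $\mathcal F_\sigma$ on the set of linkoids with strand permutation $\tau$ whose value at the class of a diagram $L_\tau$ is the value of $\mathcal F$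 at the virtual link represented by any virtual closure diagram of $L_\tau$ with respect to $\sigma$. -/

import Mathlib

noncomputable section

/-!
Polygonal diagrams on the two-sphere.  Edges are minor great-circle arcs, so a generic polygonal
diagram is a finite set of such arcs; the classical crossings carry an over/under relation, and
every other crossing is virtual.
-/

/-- The two-sphere on which all diagrams are drawn. -/
abbrev S2 : Type := Metric.sphere (0 : EuclideanSpace ℝ (Fin 3)) 1

/-- Spherical convex hull: the points of the sphere in the convex cone generated by `s`. -/
def sphHull (s : Set S2) : Set S2 :=
  {x | (x : EuclideanSpace ℝ (Fin 3)) ∈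
    PointedCone.hull ℝ ((Subtype.val : S2 → EuclideanSpace ℝ (Fin 3)) '' s)}

/-- The great-circle arc spanned by an unordered pair of (non-antipodal) points. -/
def seg (e : Sym2 S2) : Set S2 := sphHull {v | v ∈ e}

/-- The spherical triangle with vertices `a`, `b`, `c`. -/
def triangle (a b c : S2) : Set S2 := sphHull {a, b, c}

/-- Two arcs without a common end point that meet. -/
def Crosses (e f : Sym2 S2) : Prop :=
  (∀ v ∈ e, v ∉ f) ∧ (seg e ∩ seg f).Nonempty

/-- A generic polygonal diagram on the sphere, possibly with open components, with classical and
virtual crossings.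

* `short`: an edge joins two distinct non-antipodal points;
* `vertex`: a vertex lies on an edge only as an end point of it, so that any other intersection of
  two edges is a transversal crossing of their interiors;
* `no_triple`: no point lies on three edges.  So crossings are double points, and at most two
  edges meet at a vertex: the edges form polygonal arcs and closed polygons.
* `above e f`: `e` and `f` have a classical crossing, at which `e` is the over-strand. -/
structure Diagram where
  edges : Finset (Sym2 S2)
  short : ∀ a b : S2, s(a, b) ∈ edges → a ≠ b ∧ a ≠ -b
  vertex : ∀ e ∈ edges, ∀ f ∈ edges, ∀ v ∈ e, v ∈ seg f → v ∈ f
  no_triple : ∀ x : S2, ∀ e ∈ edges, ∀ f ∈ edges, ∀ g ∈ edges,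
    x ∈ seg e → x ∈ seg f → x ∈ seg g → e = f ∨ f = g ∨ e = g
  above : Sym2 S2 → Sym2 S2 → Prop
  above_crosses : ∀ e f, above e f → e ∈ edges ∧ f ∈ edges ∧ Crosses e f
  above_asymm : ∀ e f, above e f → ¬ above f e

namespace Diagram

/-- The end points of the open components: the vertices that lie on exactly one edge. -/
def IsEndpoint (D : Diagram) (v : S2) : Prop := ∃! e, e ∈ D.edges ∧ v ∈ e

/-- The edges `e`, `f` have a classical crossing. -/
def Classical (D : Diagram) (e f : Sym2 S2) : Prop := D.above e f ∨ D.above f e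

/-- The edges `e`, `f` have a virtual crossing. -/
def Virtual (D : Diagram) (e f : Sym2 S2) : Prop :=
  e ∈ D.edges ∧ f ∈ D.edges ∧ Crosses e f ∧ ¬ D.Classical e f

/-- The polygonal graph underlying the diagram (crossings are not vertices of it). -/
def graph (D : Diagram) : SimpleGraph S2 := SimpleGraph.fromEdgeSet (D.edges : Set (Sym2 S2))

/-- The crossings of `e` in `D` and of `e'` in `D'` with the edge `f` have the same type:
over, under, or (if both cross `f`) virtual. -/
def SameCrossing (D D' : Diagram) (e e' f : Sym2 S2) : Prop :=
  (D.above e f ↔ D'.above e' f) ∧ (D.above f e ↔ D'.above f e')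

open scoped Classical in
/-- `D'` arises from `D` by replacing the edge `ab` by the two edges `ac`, `cb`, with no change of
the other edges and of the crossings among them. -/
structure Replaces (D D' : Diagram) (a b c : S2) : Prop where
  mem : s(a, b) ∈ D.edges
  left_notMem : s(a, c) ∉ D.edges
  right_notMem : s(c, b) ∉ D.edges
  edges_eq : D'.edges = insert s(a, c) (insert s(c, b) (D.edges.erase s(a, b)))
  above_iff : ∀ e ∈ D.edges, ∀ f ∈ D.edges, e ≠ s(a, b) → f ≠ s(a, b) →
    (D.above e f ↔ D'.above e f)

/-- Insertion of a vertex `c` in the interior of the edge `ab`: the curves and the crossings on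
them are the same. -/
structure Subdivides (D D' : Diagram) (a b c : S2) : Prop extends Replaces D D' a b c where
  mem_seg : c ∈ seg s(a, b)
  above_left : ∀ e ∈ D.edges, e ≠ s(a, b) →
    (D.above s(a, b) e ↔ D'.above s(a, c) e ∨ D'.above s(c, b) e)
  above_right : ∀ e ∈ D.edges, e ≠ s(a, b) →
    (D.above e s(a, b) ↔ D'.above e s(a, c) ∨ D'.above e s(c, b))

/-- The common part of the local moves: the edge `ab` is pushed across the nondegenerate spherical
triangle `abc` to `ac ∪ cb`.  No end point of the diagram lies in the triangle, and it is met by no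
edges besides `ab`, those in `K`, and those which only touch it at `a` or `b`. -/
structure TriangleMove (D D' : Diagram) (a b c : S2) (K : Set (Sym2 S2)) : Prop
    extends Replaces D D' a b c where
  indep : LinearIndependent ℝ
    ![(a : EuclideanSpace ℝ (Fin 3)), (b : EuclideanSpace ℝ (Fin 3)), (c : EuclideanSpace ℝ (Fin 3))]
  no_endpoint : ∀ v ∈ triangle a b c, ¬ D.IsEndpoint v
  content : ∀ e ∈ D.edges, e ≠ s(a, b) → e ∉ K → ∀ x ∈ seg e, x ∈ triangle a b c → x = a ∨ x = b

/-- The edge `e` of `D` has both of its ends outside of the triangle `abc`. -/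
def Traverses (D : Diagram) (e : Sym2 S2) (a b c : S2) : Prop :=
  e ∈ D.edges ∧ ∀ v ∈ e, v ∉ triangle a b c

/-- The elementary moves on diagrams that are supported in a disc without end points: planar isotopy
and the three Reidemeister moves (each of them together with its inverse, once the equivalence
relation is generated).

* `subdivide`, `isotopy`, `isotopy_across`: planar isotopy.  An edge is subdivided, or pushed
  across an empty triangle, or pushed along one transversal strand (the crossing keeps its type).
* `r1`: the pushed strand forms a kink with the preceding edge `pa`.
* `r2`: the pushed strand is moved over, or under, a strand `e` that it did not meet.
* `r3`: the pushed strand passes the classical crossing of two strands `e`, `f`, both of which it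
  crosses classically.  All crossings keep their type, and one of the three strands is above
  the two others, and one is below the two others (no cyclic pattern). -/
inductive ClassicalMove (D D' : Diagram) : Prop
  | subdivide (a b c : S2) (h : Subdivides D D' a b c)
  | isotopy (a b c : S2) (h : TriangleMove D D' a b c ∅)
  | isotopy_across (a b c : S2) (e : Sym2 S2) (h : TriangleMove D D' a b c {e})
      (trav : D.Traverses e a b c)
      (old : Crosses s(a, b) e) (new : Crosses s(a, c) e)
      (type : SameCrossing D D' s(a, b) s(a, c) e)
  | r1 (p a b c : S2) (h : TriangleMove D D' a b c {s(p, a)})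
      (mem : s(p, a) ∈ D.edges) (out : p ∉ triangle a b c)
      (new : D'.Classical s(p, a) s(c, b))
  | r2 (a b c : S2) (e : Sym2 S2) (h : TriangleMove D D' a b c {e})
      (trav : D.Traverses e a b c)
      (new : (D'.above s(a, c) e ∧ D'.above s(c, b) e) ∨ (D'.above e s(a, c) ∧ D'.above e s(c, b)))
  | r3 (a b c : S2) (e f : Sym2 S2) (h : TriangleMove D D' a b c {e, f})
      (trav_left : D.Traverses e a b c) (trav_right : D.Traverses f a b c)
      (inside : (seg e ∩ seg f ∩ triangle a b c).Nonempty)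
      (classical : D.Classical e f)
      (old_left : D.Classical s(a, b) e) (new_left : D'.Classical s(a, c) e)
      (old_right : D.Classical s(a, b) f) (new_right : D'.Classical s(c, b) f)
      (type_left : SameCrossing D D' s(a, b) s(a, c) e)
      (type_right : SameCrossing D D' s(a, b) s(c, b) f)
      (acyclic : ¬ (D.above s(a, b) e ∧ D.above e f ∧ D.above f s(a, b)))
      (acyclic' : ¬ (D.above e s(a, b) ∧ D.above s(a, b) f ∧ D.above f e))

end Diagram

open scoped Classical in
/-- `P` is the set of edges of a polygonal arc from `a` to `b` that visits no vertex twice. -/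
def IsPolygonalArc (P : Finset (Sym2 S2)) (a b : S2) : Prop :=
  ∃ w : (⊤ : SimpleGraph S2).Walk a b, w.IsPath ∧ P = w.edges.toFinset

/-! ### Virtual links -/

/-- A (polygonal) virtual link diagram: all components are closed. -/
structure VirtualLinkDiagram extends Diagram where
  closed : ∀ v, ¬ toDiagram.IsEndpoint v

namespace VirtualLinkDiagram

open scoped Classical in
/-- The detour move: an arc `P` all of whose crossings are virtual is excised and replaced by
another arc `P'` with the same ends, all of whose crossings are virtual; the remaining diagram `R`
is not changed.  The virtual moves and the semi-virtual (mixed) move are special cases. -/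
def Detour (D D' : VirtualLinkDiagram) : Prop :=
  ∃ (R P P' : Finset (Sym2 S2)) (a b : S2),
    IsPolygonalArc P a b ∧ IsPolygonalArc P' a b ∧
    Disjoint R P ∧ Disjoint R P' ∧ D.edges = R ∪ P ∧ D'.edges = R ∪ P' ∧
    (∀ e ∈ P, ∀ f, ¬ D.Classical e f) ∧ (∀ e ∈ P', ∀ f, ¬ D'.Classical e f) ∧
    (∀ e ∈ R, ∀ f ∈ R, D.above e f ↔ D'.above e f)

/-- One generalized Reidemeister move (or planar isotopy). -/
def Move (D D' : VirtualLinkDiagram) : Prop :=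
  D.toDiagram.ClassicalMove D'.toDiagram ∨ Detour D D'

/-- Equivalence of virtual link diagrams. -/
def Equivalent : VirtualLinkDiagram → VirtualLinkDiagram → Prop := Relation.EqvGen Move

end VirtualLinkDiagram

/-- Virtual links: classes of virtual link diagrams under generalized Reidemeister moves. -/
def VirtualLink : Type := Quot VirtualLinkDiagram.Move

/-- The virtual link represented by a diagram. -/
def VirtualLinkDiagram.toVirtualLink (D : VirtualLinkDiagram) : VirtualLink := Quot.mk _ D

/-! ### Linkoids -/

/-- A (polygonal) linkoid diagram with `n` components, whose end points are labelled bijectively by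
`Fin (2 * n)`, with strand permutation `τ`: there is no closed component, all crossings
are classical, and `i`, `τ i` label the two ends of one component. -/
structure LinkoidDiagram (n : ℕ) (τ : Equiv.Perm (Fin (2 * n))) extends Diagram where
  no_virtual : ∀ e f, ¬ toDiagram.Virtual e f
  no_closed : toDiagram.graph.IsAcyclic
  endpt : Fin (2 * n) → S2
  endpt_injective : Function.Injective endpt
  isEndpoint_iff : ∀ v, toDiagram.IsEndpoint v ↔ v ∈ Set.range endpt
  strand_ne : ∀ i, τ i ≠ i
  strand : ∀ i, toDiagram.graph.Reachable (endpt i) (endpt (τ i))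

namespace LinkoidDiagram

variable {n : ℕ} {τ : Equiv.Perm (Fin (2 * n))}

open scoped Classical in
/-- Planar isotopy at an end point: the end labelled `i` is prolonged by one edge to a new
vertex `c`.  The new edge has no crossing, so no strand is passed over or under the end point. -/
def Prolongs (L L' : LinkoidDiagram n τ) (i : Fin (2 * n)) (c : S2) : Prop :=
  L'.endpt = Function.update L.endpt i c ∧
  (∀ e ∈ L.edges, c ∉ e ∧ ¬ Crosses e s(L.endpt i, c)) ∧
  L'.edges = insert s(L.endpt i, c) L.edges ∧
  (∀ e f, L.above e f ↔ L'.above e f)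

/-- One Reidemeister move, or planar isotopy, of linkoid diagrams with labelled end points. -/
def Move (L L' : LinkoidDiagram n τ) : Prop :=
  (L.toDiagram.ClassicalMove L'.toDiagram ∧ L'.endpt = L.endpt) ∨ ∃ i c, Prolongs L L' i c

/-- Equivalence of linkoid diagrams. -/
def Equivalent : LinkoidDiagram n τ → LinkoidDiagram n τ → Prop := Relation.EqvGen Move

end LinkoidDiagram

/-- Linkoids with `n` components, labelled end points and strand permutation `τ`. -/
def Linkoid (n : ℕ) (τ : Equiv.Perm (Fin (2 * n))) : Type :=
  Quot (LinkoidDiagram.Move (n := n) (τ := τ))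

/-- The linkoid represented by a diagram. -/
def LinkoidDiagram.toLinkoid {n : ℕ} {τ : Equiv.Perm (Fin (2 * n))} (L : LinkoidDiagram n τ) :
    Linkoid n τ := Quot.mk _ L

/-! ### Virtual closure -/

/-- A closure permutation: an involution without fixed points. -/
def IsClosurePerm {n : ℕ} (σ : Equiv.Perm (Fin (2 * n))) : Prop := σ ^ 2 = 1 ∧ ∀ i, σ i ≠ i

open scoped Classical in
/-- `D` is a diagram of the virtual closure of `L` with respect to `σ`: it consists of `L` and, for
every `i`, of a closure arc `P i = P (σ i)` between the ends labelled `i` and `σ i`.  The classical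
crossings of `D` are those of `L`, hence all crossings on the closure arcs are virtual. -/
def IsVirtualClosure {n : ℕ} {τ : Equiv.Perm (Fin (2 * n))} (σ : Equiv.Perm (Fin (2 * n)))
    (L : LinkoidDiagram n τ) (D : VirtualLinkDiagram) : Prop :=
  ∃ P : Fin (2 * n) → Finset (Sym2 S2),
    (∀ i, IsPolygonalArc (P i) (L.endpt i) (L.endpt (σ i))) ∧
    (∀ i, P (σ i) = P i) ∧
    (∀ i, Disjoint L.edges (P i)) ∧
    (∀ i j, j ≠ i → j ≠ σ i → Disjoint (P i) (P j)) ∧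
    D.edges = L.edges ∪ Finset.univ.biUnion P ∧
    (∀ e f, D.above e f ↔ L.above e f)

end

noncomputable section

/-! ### Linear algebra of great-circle arcs -/

lemma S2.eq_of_smul {x y : S2} {c : ℝ} (hc : 0 ≤ c)
    (h : (x : EuclideanSpace ℝ (Fin 3)) = c • (y : EuclideanSpace ℝ (Fin 3))) : x = y := by
  have h1 := congrArg norm h
  rw [norm_smul, norm_eq_of_mem_sphere, norm_eq_of_mem_sphere, Real.norm_of_nonneg hc,
    mul_one] at h1
  apply Subtype.ext
  rw [h, ← h1, one_smul]

lemma S2.coe_ne_zero (x : S2) : (x : EuclideanSpace ℝ (Fin 3)) ≠ 0 :=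
  ne_zero_of_mem_unit_sphere x

lemma S2.smul_eq_smul {p q : S2} (h : p ≠ q) (h' : p ≠ -q) {c d : ℝ}
    (hcd : c • (p : EuclideanSpace ℝ (Fin 3)) = d • (q : EuclideanSpace ℝ (Fin 3))) :
    c = 0 ∧ d = 0 := by
  have hc : c = 0 := by
    by_contra hc
    have hp : (p : EuclideanSpace ℝ (Fin 3)) = (c⁻¹ * d) • (q : EuclideanSpace ℝ (Fin 3)) := by
      rw [mul_smul, ← hcd, smul_smul, inv_mul_cancel₀ hc, one_smul]
    rcases le_total 0 (c⁻¹ * d) with h0 | h0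
    · exact h (S2.eq_of_smul h0 hp)
    · refine h' (S2.eq_of_smul (c := -(c⁻¹ * d)) (by linarith) ?_)
      rw [hp]
      simp
  refine ⟨hc, ?_⟩
  rw [hc, zero_smul] at hcd
  exact (smul_eq_zero.mp hcd.symm).resolve_right (S2.coe_ne_zero q)

lemma coe_image_setOf_mem_mk (p q : S2) :
    (Subtype.val : S2 → EuclideanSpace ℝ (Fin 3)) '' {v | v ∈ s(p, q)} =
      {(p : EuclideanSpace ℝ (Fin 3)), (q : EuclideanSpace ℝ (Fin 3))} := by
  ext y
  simp only [Sym2.mem_iff, Set.mem_image, Set.mem_ofPred_eq, Set.mem_insert_iff,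
    Set.mem_singleton_iff]
  constructor
  · rintro ⟨v, rfl | rfl, rfl⟩ <;> simp
  · rintro (rfl | rfl)
    · exact ⟨p, Or.inl rfl, rfl⟩
    · exact ⟨q, Or.inr rfl, rfl⟩

lemma mem_seg_iff {p q x : S2} : x ∈ seg s(p, q) ↔ ∃ s t : ℝ, 0 ≤ s ∧ 0 ≤ t ∧
    s • (p : EuclideanSpace ℝ (Fin 3)) + t • (q : EuclideanSpace ℝ (Fin 3)) = x := by
  simp only [seg, sphHull, Set.mem_ofPred_eq, coe_image_setOf_mem_mk, PointedCone.hull,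
    Submodule.mem_span_pair]
  constructor
  · rintro ⟨s, t, hst⟩
    exact ⟨s, t, s.2, t.2, hst⟩
  · rintro ⟨s, t, hs, ht, hst⟩
    exact ⟨⟨s, hs⟩, ⟨t, ht⟩, hst⟩

lemma coe_image_insert_insert (a b c : S2) :
    (Subtype.val : S2 → EuclideanSpace ℝ (Fin 3)) '' {a, b, c} =
      {(a : EuclideanSpace ℝ (Fin 3)), (b : EuclideanSpace ℝ (Fin 3)),
        (c : EuclideanSpace ℝ (Fin 3))} := by
  simp [Set.image_insert_eq]

lemma mem_triangle_of_nonneg {a b c x : S2} {α β γ : ℝ} (hα : 0 ≤ α) (hβ : 0 ≤ β) (hγ : 0 ≤ γ)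
    (h : α • (a : EuclideanSpace ℝ (Fin 3)) + β • (b : EuclideanSpace ℝ (Fin 3)) +
      γ • (c : EuclideanSpace ℝ (Fin 3)) = x) : x ∈ triangle a b c := by
  simp only [triangle, sphHull, Set.mem_ofPred_eq, coe_image_insert_insert, PointedCone.hull,
    Submodule.mem_span_triple]
  exact ⟨⟨α, hα⟩, ⟨β, hβ⟩, ⟨γ, hγ⟩, h⟩

lemma exists_of_mem_triangle {a b c x : S2} (hx : x ∈ triangle a b c) :
    ∃ α β γ : ℝ, 0 ≤ α ∧ 0 ≤ β ∧ 0 ≤ γ ∧ α • (a : EuclideanSpace ℝ (Fin 3)) +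
      β • (b : EuclideanSpace ℝ (Fin 3)) + γ • (c : EuclideanSpace ℝ (Fin 3)) = x := by
  simp only [triangle, sphHull, Set.mem_ofPred_eq, coe_image_insert_insert, PointedCone.hull,
    Submodule.mem_span_triple] at hx
  obtain ⟨α, β, γ, h⟩ := hx
  exact ⟨α, β, γ, α.2, β.2, γ.2, h⟩

lemma mem_seg_of_mem {e : Sym2 S2} {v : S2} (h : v ∈ e) : v ∈ seg e :=
  PointedCone.subset_hull ⟨v, h, rfl⟩

/-- The linear span of the end points of an edge. -/
def edgePlane (e : Sym2 S2) : Submodule ℝ (EuclideanSpace ℝ (Fin 3)) :=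
  Submodule.span ℝ ((Subtype.val : S2 → EuclideanSpace ℝ (Fin 3)) '' {v | v ∈ e})

lemma coe_mem_edgePlane {e : Sym2 S2} {v : S2} (h : v ∈ e) :
    (v : EuclideanSpace ℝ (Fin 3)) ∈ edgePlane e :=
  Submodule.subset_span ⟨v, h, rfl⟩

lemma mem_edgePlane_of_mem_seg {e : Sym2 S2} {x : S2} (h : x ∈ seg e) :
    (x : EuclideanSpace ℝ (Fin 3)) ∈ edgePlane e := by
  induction e with
  | _ p q =>
    obtain ⟨s, t, -, -, hst⟩ := mem_seg_iff.mp h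
    rw [← hst]
    exact add_mem (Submodule.smul_mem _ _ (coe_mem_edgePlane (Sym2.mem_mk_left p q)))
      (Submodule.smul_mem _ _ (coe_mem_edgePlane (Sym2.mem_mk_right p q)))

lemma mem_edgePlane_mk {p q : S2} {x : EuclideanSpace ℝ (Fin 3)} (h : x ∈ edgePlane s(p, q)) :
    ∃ s t : ℝ, s • (p : EuclideanSpace ℝ (Fin 3)) + t • (q : EuclideanSpace ℝ (Fin 3)) = x := by
  rwa [edgePlane, coe_image_setOf_mem_mk, Submodule.mem_span_pair] at h

lemma finrank_span_pair_le (u v : EuclideanSpace ℝ (Fin 3)) :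
    Module.finrank ℝ (Submodule.span ℝ {u, v}) ≤ 2 := by
  classical
  have h := finrank_span_finset_le_card (R := ℝ) ({u, v} : Finset (EuclideanSpace ℝ (Fin 3)))
  rw [Finset.coe_pair] at h
  exact h.trans Finset.card_le_two

lemma finrank_edgePlane_le (e : Sym2 S2) : Module.finrank ℝ (edgePlane e) ≤ 2 := by
  induction e with
  | _ p q =>
    refine le_trans (Submodule.finrank_mono ?_) (finrank_span_pair_le p q)
    intro x hx
    obtain ⟨s, t, h⟩ := mem_edgePlane_mk hx
    exact Submodule.mem_span_pair.mpr ⟨s, t, h⟩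

lemma ne_top_of_finrank_le_two {S : Submodule ℝ (EuclideanSpace ℝ (Fin 3))}
    (h : Module.finrank ℝ S ≤ 2) : S ≠ ⊤ := by
  rintro rfl
  simp at h

lemma finrank_sup_edgePlane_inf_le (a : S2) {e f : Sym2 S2} (h : edgePlane e ≠ edgePlane f) :
    Module.finrank ℝ (Submodule.span ℝ {(a : EuclideanSpace ℝ (Fin 3))} ⊔
      (edgePlane e ⊓ edgePlane f) : Submodule ℝ (EuclideanSpace ℝ (Fin 3))) ≤ 2 := by
  have h1 : Module.finrank ℝ (edgePlane e ⊓ edgePlane f :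
      Submodule ℝ (EuclideanSpace ℝ (Fin 3))) ≤ 1 := by
    by_contra hlt
    apply h
    have he := Submodule.eq_of_le_of_finrank_le (inf_le_left : edgePlane e ⊓ edgePlane f ≤ _)
      (by have := finrank_edgePlane_le e; omega)
    have hf := Submodule.eq_of_le_of_finrank_le (inf_le_right : edgePlane e ⊓ edgePlane f ≤ _)
      (by have := finrank_edgePlane_le f; omega)
    exact he.symm.trans hf
  have h2 := finrank_span_pair_le (a : EuclideanSpace ℝ (Fin 3)) a
  have h3 : Module.finrank ℝ (Submodule.span ℝ {(a : EuclideanSpace ℝ (Fin 3))}) ≤ 1 :=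
    (finrank_span_singleton (K := ℝ) (S2.coe_ne_zero a)).le
  have h4 := Submodule.finrank_add_le_finrank_add_finrank
    (Submodule.span ℝ {(a : EuclideanSpace ℝ (Fin 3))}) (edgePlane e ⊓ edgePlane f)
  omega

lemma exists_mem_forall_notMem_submodule {ι : Type*} {I : Set ι} (hI : I.Finite)
    (S : ι → Submodule ℝ (EuclideanSpace ℝ (Fin 3))) (hS : ∀ i ∈ I, S i ≠ ⊤)
    {U : Set (EuclideanSpace ℝ (Fin 3))} (hU : IsOpen U) (hne : U.Nonempty)
    (hcone : ∀ v ∈ U, ∀ c : ℝ, 0 < c → c • v ∈ U) :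
    ∃ m : S2, (m : EuclideanSpace ℝ (Fin 3)) ∈ U ∧
      ∀ i ∈ I, (m : EuclideanSpace ℝ (Fin 3)) ∉ S i := by
  have hbot : (⊥ : Submodule ℝ (EuclideanSpace ℝ (Fin 3))) ≠ ⊤ :=
    ne_top_of_finrank_le_two (by simp)
  have h0 : MeasureTheory.volume ((⋃ i ∈ I, (S i : Set (EuclideanSpace ℝ (Fin 3)))) ∪
      ((⊥ : Submodule ℝ (EuclideanSpace ℝ (Fin 3))) : Set (EuclideanSpace ℝ (Fin 3)))) = 0 := by
    refine MeasureTheory.measure_union_null ?_ (MeasureTheory.Measure.addHaar_submodule _ _ hbot)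
    exact (MeasureTheory.measure_biUnion_null_iff hI.countable).mpr fun i hi =>
      MeasureTheory.Measure.addHaar_submodule _ _ (hS i hi)
  have hpos := hU.measure_pos MeasureTheory.volume hne
  obtain ⟨v, hvU, hv⟩ : ∃ v ∈ U, v ∉ (⋃ i ∈ I, (S i : Set (EuclideanSpace ℝ (Fin 3)))) ∪
      ((⊥ : Submodule ℝ (EuclideanSpace ℝ (Fin 3))) : Set (EuclideanSpace ℝ (Fin 3))) := by
    by_contra! hsub
    exact hpos.ne' (MeasureTheory.measure_mono_null hsub h0)
  simp only [Set.mem_union, Set.mem_iUnion, not_or, SetLike.mem_coe, Submodule.mem_bot,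
    not_exists] at hv
  have hpos : 0 < ‖v‖⁻¹ := inv_pos.mpr (norm_pos_iff.mpr hv.2)
  refine ⟨⟨‖v‖⁻¹ • v, ?_⟩, hcone v hvU _ hpos, fun i hi hm => hv.1 i hi ?_⟩
  · rw [mem_sphere_zero_iff_norm, norm_smul, norm_inv, norm_norm,
      inv_mul_cancel₀ (norm_ne_zero_iff.mpr hv.2)]
  · exact ((S i).smul_mem_iff hpos.ne').mp hm

/-! ### Overlapping edges on one great circle -/

lemma mem_seg_or_mem_seg_of_same_side {x p q r s : S2} {ρ θ : ℝ} (hθ : 0 < θ)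
    (hr : (r : EuclideanSpace ℝ (Fin 3)) = ρ • (x : EuclideanSpace ℝ (Fin 3)) +
      θ • (p : EuclideanSpace ℝ (Fin 3)))
    (hx : x ∈ seg s(p, q)) (hx' : x ∈ seg s(r, s)) : p ∈ seg s(r, s) ∨ r ∈ seg s(p, q) := by
  obtain ⟨α, β, hα, hβ, h1⟩ := mem_seg_iff.mp hx
  obtain ⟨γ, δ, hγ, hδ, h2⟩ := mem_seg_iff.mp hx'
  rcases le_total 0 ρ with hρ | hρ
  · right
    refine mem_seg_iff.mpr ⟨ρ * α + θ, ρ * β, by positivity, by positivity, ?_⟩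
    rw [hr, ← h1]
    module
  · left
    have h3 : 0 ≤ -ρ := by linarith
    refine mem_seg_iff.mpr ⟨θ⁻¹ * (1 + -ρ * γ), θ⁻¹ * (-ρ * δ), by positivity, by positivity, ?_⟩
    have h4 : (p : EuclideanSpace ℝ (Fin 3)) = θ⁻¹ • ((r : EuclideanSpace ℝ (Fin 3)) -
        ρ • (x : EuclideanSpace ℝ (Fin 3))) := by
      rw [hr, add_sub_cancel_left, smul_smul, inv_mul_cancel₀ hθ.ne', one_smul]
    rw [h4, ← h2]
    module

namespace Diagram

lemma false_of_same_side (D : Diagram) {x p q r s : S2} (he : s(p, q) ∈ D.edges)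
    (hf : s(r, s) ∈ D.edges) (hne : s(p, q) ≠ s(r, s)) {α β γ δ ρ θ : ℝ} (hα : 0 < α) (hβ : 0 < β)
    (hγ : 0 < γ) (hδ : 0 < δ)
    (h1 : α • (p : EuclideanSpace ℝ (Fin 3)) + β • (q : EuclideanSpace ℝ (Fin 3)) = x)
    (h2 : γ • (r : EuclideanSpace ℝ (Fin 3)) + δ • (s : EuclideanSpace ℝ (Fin 3)) = x) (hθ : 0 < θ)
    (hr : (r : EuclideanSpace ℝ (Fin 3)) = ρ • (x : EuclideanSpace ℝ (Fin 3)) +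
      θ • (p : EuclideanSpace ℝ (Fin 3))) : False := by
  have hpq := D.short p q he
  have hrs := D.short r s hf
  have hcases : p = r ∨ p = s ∨ r = q := by
    rcases mem_seg_or_mem_seg_of_same_side hθ hr (mem_seg_iff.mpr ⟨α, β, hα.le, hβ.le, h1⟩)
      (mem_seg_iff.mpr ⟨γ, δ, hγ.le, hδ.le, h2⟩) with h | h
    · have := D.vertex _ he _ hf p (Sym2.mem_mk_left p q) h
      simp only [Sym2.mem_iff] at this
      tauto
    · have := D.vertex _ hf _ he r (Sym2.mem_mk_left r s) h
      simp only [Sym2.mem_iff] at this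
      rcases this with h | h
      · exact Or.inl h.symm
      · exact Or.inr (Or.inr h)
  rcases hcases with rfl | rfl | rfl
  · rcases le_total γ α with hle | hle
    · have hs : s ∈ seg s(p, q) := by
        refine mem_seg_iff.mpr ⟨δ⁻¹ * (α - γ), δ⁻¹ * β, mul_nonneg (by positivity) (by linarith),
          by positivity, ?_⟩
        have : δ • (s : EuclideanSpace ℝ (Fin 3)) = (α - γ) • (p : EuclideanSpace ℝ (Fin 3)) +
            β • (q : EuclideanSpace ℝ (Fin 3)) := by
          linear_combination (norm := module) h2 - h1
        rw [mul_smul, mul_smul, ← smul_add, ← this, smul_smul, inv_mul_cancel₀ hδ.ne', one_smul]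
      have := D.vertex _ hf _ he s (Sym2.mem_mk_right p s) hs
      rcases Sym2.mem_iff.mp this with h | h
      · exact hrs.1 h.symm
      · exact hne (by rw [h])
    · have hs : q ∈ seg s(p, s) := by
        refine mem_seg_iff.mpr ⟨β⁻¹ * (γ - α), β⁻¹ * δ, mul_nonneg (by positivity) (by linarith),
          by positivity, ?_⟩
        have : β • (q : EuclideanSpace ℝ (Fin 3)) = (γ - α) • (p : EuclideanSpace ℝ (Fin 3)) +
            δ • (s : EuclideanSpace ℝ (Fin 3)) := by
          linear_combination (norm := module) h1 - h2
        rw [mul_smul, mul_smul, ← smul_add, ← this, smul_smul, inv_mul_cancel₀ hβ.ne', one_smul]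
      have := D.vertex _ he _ hf q (Sym2.mem_mk_right p q) hs
      rcases Sym2.mem_iff.mp this with h | h
      · exact hpq.1 h.symm
      · exact hne (by rw [h])
  · have h3 : ((1 - γ * ρ) * β) • (q : EuclideanSpace ℝ (Fin 3)) =
        (γ * θ + δ - (1 - γ * ρ) * α) • (p : EuclideanSpace ℝ (Fin 3)) := by
      linear_combination (norm := module) (1 - γ * ρ) • h1 - h2 + γ • hr
    obtain ⟨h4, h5⟩ := S2.smul_eq_smul hpq.1 hpq.2 h3.symm
    have h6 : 1 - γ * ρ = 0 := (mul_eq_zero.mp h5).resolve_right hβ.ne'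
    rw [h6] at h4
    nlinarith
  · have h3 : (θ + ρ * α) • (p : EuclideanSpace ℝ (Fin 3)) =
        (1 - ρ * β) • (r : EuclideanSpace ℝ (Fin 3)) := by
      linear_combination (norm := module) ρ • h1 - hr
    obtain ⟨h4, h5⟩ := S2.smul_eq_smul hpq.1 hpq.2 h3
    have : 0 < ρ := by
      by_contra hneg
      nlinarith
    nlinarith

/-- Two edges on one great circle can only meet in a common end point. -/
lemma mem_of_edgePlane_eq (D : Diagram) {e f : Sym2 S2} (he : e ∈ D.edges) (hf : f ∈ D.edges)
    (hne : e ≠ f) (hplane : edgePlane e = edgePlane f) {x : S2} (hxe : x ∈ seg e)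
    (hxf : x ∈ seg f) : x ∈ e := by
  by_contra hx
  have hx' : x ∉ f := fun h => hx (D.vertex f hf e he x h hxe)
  induction e with
  | _ p q =>
  induction f with
  | _ r s =>
  obtain ⟨α, β, hα, hβ, h1⟩ := mem_seg_iff.mp hxe
  obtain ⟨γ, δ, hγ, hδ, h2⟩ := mem_seg_iff.mp hxf
  simp only [Sym2.mem_iff, not_or] at hx hx'
  have hα : 0 < α := lt_of_le_of_ne hα fun h => hx.2 (S2.eq_of_smul hβ (by rw [← h1, ← h]; simp))
  have hβ : 0 < β := lt_of_le_of_ne hβ fun h =>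
    hx.1 (S2.eq_of_smul hα.le (by rw [← h1, ← h]; simp))
  have hγ : 0 < γ := lt_of_le_of_ne hγ fun h =>
    hx'.2 (S2.eq_of_smul hδ (by rw [← h2, ← h]; simp))
  have hδ : 0 < δ := lt_of_le_of_ne hδ fun h =>
    hx'.1 (S2.eq_of_smul hγ.le (by rw [← h2, ← h]; simp))
  obtain ⟨l, μ, hr⟩ := mem_edgePlane_mk
    (hplane ▸ coe_mem_edgePlane (Sym2.mem_mk_left r s) : (r : EuclideanSpace ℝ (Fin 3)) ∈ _)
  obtain ⟨ρ, θ, hr⟩ : ∃ ρ θ : ℝ, (r : EuclideanSpace ℝ (Fin 3)) =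
      ρ • (x : EuclideanSpace ℝ (Fin 3)) + θ • (p : EuclideanSpace ℝ (Fin 3)) := by
    refine ⟨μ * β⁻¹, l - μ * β⁻¹ * α, ?_⟩
    rw [← hr, ← h1]
    match_scalars <;> field_simp
    ring
  have hs : (s : EuclideanSpace ℝ (Fin 3)) = (δ⁻¹ * (1 - γ * ρ)) • (x : EuclideanSpace ℝ (Fin 3)) +
      (δ⁻¹ * (-γ * θ)) • (p : EuclideanSpace ℝ (Fin 3)) := by
    have h3 : δ • (s : EuclideanSpace ℝ (Fin 3)) = (1 - γ * ρ) • (x : EuclideanSpace ℝ (Fin 3)) +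
        (-γ * θ) • (p : EuclideanSpace ℝ (Fin 3)) := by
      linear_combination (norm := module) h2 - γ • hr
    rw [mul_smul, mul_smul, ← smul_add, ← h3, smul_smul, inv_mul_cancel₀ hδ.ne', one_smul]
  rcases lt_trichotomy θ 0 with hθ | rfl | hθ
  · refine D.false_of_same_side he (Sym2.eq_swap ▸ hf) (Sym2.eq_swap (a := r) ▸ hne) hα hβ hδ hγ h1
      ((add_comm _ _).trans h2) ?_ hs
    have : 0 < γ * -θ := mul_pos hγ (by linarith)
    exact mul_pos (inv_pos.mpr hδ) (by linarith)
  · simp only [zero_smul, add_zero, mul_zero] at hr hs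
    rcases le_total 0 ρ with hρ | hρ
    · exact hx'.1 (S2.eq_of_smul hρ hr).symm
    · have : 0 ≤ γ * -ρ := mul_nonneg hγ.le (by linarith)
      exact hx'.2 (S2.eq_of_smul (mul_nonneg (inv_pos.mpr hδ).le (by linarith)) hs).symm
  · exact D.false_of_same_side he hf hne hα hβ hγ hδ h1 h2 hθ hr

end Diagram

open scoped Classical

/-! ### Adding an arc with one generic intermediate vertex -/

/-- The point `m` avoids the great circles through `a` that are relevant for the edges in `R`. -/
structure GenericFrom (R : Finset (Sym2 S2)) (a m : S2) : Prop where
  notMem_edgePlane : ∀ e ∈ R, (m : EuclideanSpace ℝ (Fin 3)) ∉ edgePlane e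
  notMem_vertex : ∀ e ∈ R, ∀ v ∈ e, (m : EuclideanSpace ℝ (Fin 3)) ∉
    Submodule.span ℝ {(v : EuclideanSpace ℝ (Fin 3)), (a : EuclideanSpace ℝ (Fin 3))}
  notMem_inf : ∀ e ∈ R, ∀ f ∈ R, edgePlane e ≠ edgePlane f → (m : EuclideanSpace ℝ (Fin 3)) ∉
    Submodule.span ℝ {(a : EuclideanSpace ℝ (Fin 3))} ⊔ (edgePlane e ⊓ edgePlane f)

lemma GenericFrom.mono {R R' : Finset (Sym2 S2)} {a m : S2} (h : GenericFrom R a m)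
    (hR : R' ⊆ R) : GenericFrom R' a m where
  notMem_edgePlane e he := h.notMem_edgePlane e (hR he)
  notMem_vertex e he := h.notMem_vertex e (hR he)
  notMem_inf e he f hf := h.notMem_inf e (hR he) f (hR hf)

lemma GenericFrom.notMem_of_mem {R : Finset (Sym2 S2)} {a m : S2} (h : GenericFrom R a m)
    {e : Sym2 S2} (he : e ∈ R) : m ∉ e :=
  fun hm => h.notMem_edgePlane e he (coe_mem_edgePlane hm)

lemma GenericFrom.notMem_seg {R : Finset (Sym2 S2)} {a m : S2} (h : GenericFrom R a m)
    {e : Sym2 S2} (he : e ∈ R) : m ∉ seg e :=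
  fun hm => h.notMem_edgePlane e he (mem_edgePlane_of_mem_seg hm)

lemma mem_submodule_of_mem_seg {S : Submodule ℝ (EuclideanSpace ℝ (Fin 3))} {a m x : S2}
    (ha : (a : EuclideanSpace ℝ (Fin 3)) ∈ S) (hx : (x : EuclideanSpace ℝ (Fin 3)) ∈ S)
    (h : x ∈ seg s(a, m)) (hxa : x ≠ a) : (m : EuclideanSpace ℝ (Fin 3)) ∈ S := by
  obtain ⟨s, t, hs, ht, hst⟩ := mem_seg_iff.mp h
  have ht0 : t ≠ 0 := by
    rintro rfl
    exact hxa (S2.eq_of_smul hs (by rw [← hst]; simp))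
  refine (S.smul_mem_iff ht0).mp ?_
  rw [← add_sub_cancel_left (s • (a : EuclideanSpace ℝ (Fin 3))) (t • _), hst]
  exact sub_mem hx (S.smul_mem s ha)

lemma GenericFrom.eq_of_mem_seg {R : Finset (Sym2 S2)} {a m v : S2} (h : GenericFrom R a m)
    {e : Sym2 S2} (he : e ∈ R) (hv : v ∈ e) (hvs : v ∈ seg s(a, m)) : v = a := by
  by_contra hva
  exact h.notMem_vertex e he v hv (mem_submodule_of_mem_seg
    (Submodule.subset_span (by simp)) (Submodule.subset_span (by simp)) hvs hva)

lemma eq_of_mem_seg_of_mem_seg {a b m x : S2} (hab : a ≠ b)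
    (hm : (m : EuclideanSpace ℝ (Fin 3)) ∉
      Submodule.span ℝ {(a : EuclideanSpace ℝ (Fin 3)), (b : EuclideanSpace ℝ (Fin 3))})
    (ha : x ∈ seg s(a, m)) (hb : x ∈ seg s(b, m)) : x = m := by
  obtain ⟨s, t, hs, ht, h1⟩ := mem_seg_iff.mp ha
  obtain ⟨s', t', hs', ht', h2⟩ := mem_seg_iff.mp hb
  have htt : t - t' = 0 := by
    by_contra hne
    apply hm
    refine (Submodule.smul_mem_iff _ hne).mp (Submodule.mem_span_pair.mpr ⟨-s, s', ?_⟩)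
    linear_combination (norm := module) h2 - h1
  have hss : s • (a : EuclideanSpace ℝ (Fin 3)) = s' • (b : EuclideanSpace ℝ (Fin 3)) := by
    have h3 : (t - t') • (m : EuclideanSpace ℝ (Fin 3)) = 0 := by rw [htt, zero_smul]
    linear_combination (norm := module) h1 - h2 - h3
  have hs0 : s = 0 := by
    by_contra hne
    apply hab
    refine S2.eq_of_smul (c := s⁻¹ * s') (by positivity) ?_
    rw [mul_smul, ← hss, smul_smul, inv_mul_cancel₀ hne, one_smul]
  exact S2.eq_of_smul ht (by rw [← h1, hs0]; simp)

/-- The great circles that `GenericFrom R a` avoids. -/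
def exceptionalPlanes (R : Finset (Sym2 S2)) (a : S2) :
    Set (Submodule ℝ (EuclideanSpace ℝ (Fin 3))) :=
  edgePlane '' R ∪
  (⋃ e ∈ R, (fun v : S2 => Submodule.span ℝ {(v : EuclideanSpace ℝ (Fin 3)),
    (a : EuclideanSpace ℝ (Fin 3))}) '' {v | v ∈ e}) ∪
  (fun p : Sym2 S2 × Sym2 S2 => Submodule.span ℝ {(a : EuclideanSpace ℝ (Fin 3))} ⊔
    (edgePlane p.1 ⊓ edgePlane p.2)) '' {p | p ∈ R ×ˢ R ∧ edgePlane p.1 ≠ edgePlane p.2}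

lemma finite_exceptionalPlanes (R : Finset (Sym2 S2)) (a : S2) :
    (exceptionalPlanes R a).Finite := by
  refine (((R.finite_toSet.image _).union ?_)).union (Set.Finite.image _ ?_)
  · refine R.finite_toSet.biUnion fun e _ => Set.Finite.image _ ?_
    induction e with
    | _ p q =>
      refine (Set.toFinite {p, q}).subset fun v hv => ?_
      simpa using hv
  · exact (R ×ˢ R).finite_toSet.subset fun p hp => hp.1

lemma ne_top_of_mem_exceptionalPlanes {R : Finset (Sym2 S2)} {a : S2}
    {S : Submodule ℝ (EuclideanSpace ℝ (Fin 3))} (hS : S ∈ exceptionalPlanes R a) : S ≠ ⊤ := by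
  apply ne_top_of_finrank_le_two
  rcases hS with (⟨e, -, rfl⟩ | hS) | ⟨p, ⟨-, hp⟩, rfl⟩
  · exact finrank_edgePlane_le e
  · simp only [Set.mem_iUnion] at hS
    obtain ⟨e, -, v, -, rfl⟩ := hS
    exact finrank_span_pair_le _ _
  · exact finrank_sup_edgePlane_inf_le a hp

lemma genericFrom_of_forall_notMem {R : Finset (Sym2 S2)} {a m : S2}
    (h : ∀ S ∈ exceptionalPlanes R a, (m : EuclideanSpace ℝ (Fin 3)) ∉ S) : GenericFrom R a m where
  notMem_edgePlane e he := h _ (Or.inl (Or.inl ⟨e, he, rfl⟩))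
  notMem_vertex e he v hv := h _ (Or.inl (Or.inr (Set.mem_biUnion (x := e) he ⟨v, hv, rfl⟩)))
  notMem_inf e he f hf hne := h _ (Or.inr ⟨(e, f), ⟨Finset.mk_mem_product he hf, hne⟩, rfl⟩)

lemma exists_genericFrom (R : Finset (Sym2 S2)) (a b : S2) {U : Set (EuclideanSpace ℝ (Fin 3))}
    (hU : IsOpen U) (hne : U.Nonempty) (hcone : ∀ v ∈ U, ∀ c : ℝ, 0 < c → c • v ∈ U) :
    ∃ m : S2, (m : EuclideanSpace ℝ (Fin 3)) ∈ U ∧ GenericFrom R a m ∧ GenericFrom R b m ∧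
      (m : EuclideanSpace ℝ (Fin 3)) ∉
        Submodule.span ℝ {(a : EuclideanSpace ℝ (Fin 3)), (b : EuclideanSpace ℝ (Fin 3))} := by
  obtain ⟨m, hmU, hm⟩ := exists_mem_forall_notMem_submodule
    (I := insert (Submodule.span ℝ {(a : EuclideanSpace ℝ (Fin 3)),
      (b : EuclideanSpace ℝ (Fin 3))}) (exceptionalPlanes R a ∪ exceptionalPlanes R b))
    (((finite_exceptionalPlanes R a).union (finite_exceptionalPlanes R b)).insert _) id
    (by
      rintro S (rfl | hS | hS)
      · exact ne_top_of_finrank_le_two (finrank_span_pair_le _ _)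
      · exact ne_top_of_mem_exceptionalPlanes hS
      · exact ne_top_of_mem_exceptionalPlanes hS) hU hne hcone
  exact ⟨m, hmU, genericFrom_of_forall_notMem fun S hS => hm S (Or.inr (Or.inl hS)),
    genericFrom_of_forall_notMem fun S hS => hm S (Or.inr (Or.inr hS)), hm _ (Or.inl rfl)⟩

namespace Diagram

lemma IsEndpoint.eq {D : Diagram} {v : S2} (h : D.IsEndpoint v) {e f : Sym2 S2}
    (he : e ∈ D.edges) (hve : v ∈ e) (hf : f ∈ D.edges) (hvf : v ∈ f) : e = f :=
  ExistsUnique.unique h ⟨he, hve⟩ ⟨hf, hvf⟩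

lemma IsEndpoint.mem_of_mem_seg {D : Diagram} {v : S2} (h : D.IsEndpoint v) {e : Sym2 S2}
    (he : e ∈ D.edges) (hv : v ∈ seg e) : v ∈ e := by
  obtain ⟨f, ⟨hf, hvf⟩, -⟩ := h
  exact D.vertex f hf e he v hvf hv

lemma eq_or_eq_or_eq_of_mem (D : Diagram) {v : S2} {e f g : Sym2 S2} (he : e ∈ D.edges)
    (hf : f ∈ D.edges) (hg : g ∈ D.edges) (hve : v ∈ e) (hvf : v ∈ f) (hvg : v ∈ g) :
    e = f ∨ f = g ∨ e = g :=
  D.no_triple v e he f hf g hg (mem_seg_of_mem hve) (mem_seg_of_mem hvf) (mem_seg_of_mem hvg)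

lemma eq_of_mem_seg_of_genericFrom {D : Diagram} {a m : S2} (ha : D.IsEndpoint a)
    (hm : GenericFrom D.edges a m) {e f : Sym2 S2} (he : e ∈ D.edges) (hf : f ∈ D.edges) {x : S2}
    (hxe : x ∈ seg e) (hxf : x ∈ seg f) (hx : x ∈ seg s(a, m)) : e = f := by
  by_contra hne
  by_cases hxa : x = a
  · subst hxa
    exact hne (ha.eq he (ha.mem_of_mem_seg he hxe) hf (ha.mem_of_mem_seg hf hxf))
  · by_cases hplane : edgePlane e = edgePlane f
    · exact hxa (hm.eq_of_mem_seg he (D.mem_of_edgePlane_eq he hf hne hplane hxe hxf) hx)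
    · refine hm.notMem_inf e he f hf hplane (mem_submodule_of_mem_seg ?_ ?_ hx hxa)
      · exact Submodule.mem_sup_left (Submodule.mem_span_singleton_self _)
      · exact Submodule.mem_sup_right
          ⟨mem_edgePlane_of_mem_seg hxe, mem_edgePlane_of_mem_seg hxf⟩

lemma ne_of_genericFrom {D : Diagram} {a m : S2} (ha : D.IsEndpoint a)
    (hm : GenericFrom D.edges a m) : a ≠ m := by
  rintro rfl
  obtain ⟨e, ⟨he, hae⟩, -⟩ := ha
  exact hm.notMem_of_mem he hae

lemma ne_neg_of_genericFrom {D : Diagram} {a m : S2} (ha : D.IsEndpoint a)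
    (hm : GenericFrom D.edges a m) : a ≠ -m := by
  rintro rfl
  obtain ⟨e, ⟨he, hae⟩, -⟩ := ha
  apply hm.notMem_edgePlane e he
  have := neg_mem (coe_mem_edgePlane hae)
  simpa using this

/-- A generic vertex `m` gives an arc `am ∪ mb` that can be added to the diagram. -/
def addArc (D : Diagram) {a b m : S2} (ha : D.IsEndpoint a) (hb : D.IsEndpoint b) (hab : a ≠ b)
    (hma : GenericFrom D.edges a m) (hmb : GenericFrom D.edges b m)
    (hm : (m : EuclideanSpace ℝ (Fin 3)) ∉
      Submodule.span ℝ {(a : EuclideanSpace ℝ (Fin 3)), (b : EuclideanSpace ℝ (Fin 3))}) :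
    Diagram where
  edges := D.edges ∪ {s(a, m), s(b, m)}
  short p q h := by
    simp only [Finset.mem_union, Finset.mem_insert, Finset.mem_singleton] at h
    have key : ∀ {c : S2}, D.IsEndpoint c → GenericFrom D.edges c m → s(p, q) = s(c, m) →
        p ≠ q ∧ p ≠ -q := by
      intro c hc hmc h
      have h1 := ne_of_genericFrom hc hmc
      have h2 := ne_neg_of_genericFrom hc hmc
      rcases Sym2.eq_iff.mp h with ⟨rfl, rfl⟩ | ⟨rfl, rfl⟩
      · exact ⟨h1, h2⟩
      · exact ⟨h1.symm, fun h => h2 (by rw [h, neg_neg])⟩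
    rcases h with h | h | h
    · exact D.short p q h
    · exact key ha hma h
    · exact key hb hmb h
  vertex := by
    have new_old : ∀ {c : S2}, D.IsEndpoint c → GenericFrom D.edges c m → ∀ f ∈ D.edges,
        ∀ v ∈ s(c, m), v ∈ seg f → v ∈ f := by
      intro c hc hmc f hf v hv hvf
      rcases Sym2.mem_iff.mp hv with rfl | rfl
      · exact hc.mem_of_mem_seg hf hvf
      · exact absurd hvf (hmc.notMem_seg hf)
    have old_new : ∀ {c : S2}, GenericFrom D.edges c m → ∀ e ∈ D.edges, ∀ v ∈ e,
        v ∈ seg s(c, m) → v ∈ s(c, m) := by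
      intro c hmc e he v hv hvf
      rw [hmc.eq_of_mem_seg he hv hvf]
      exact Sym2.mem_mk_left c m
    have new_new : ∀ {c d : S2}, D.IsEndpoint c → GenericFrom D.edges d m → ∀ v ∈ s(c, m),
        v ∈ seg s(d, m) → v ∈ s(d, m) := by
      intro c d hc hmd v hv hvd
      rcases Sym2.mem_iff.mp hv with rfl | rfl
      · obtain ⟨e, ⟨he, hce⟩, -⟩ := hc
        exact old_new hmd e he v hce hvd
      · exact Sym2.mem_mk_right d v
    intro e he f hf v hve hvf
    simp only [Finset.mem_union, Finset.mem_insert, Finset.mem_singleton] at he hf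
    rcases he with he | rfl | rfl <;> rcases hf with hf | rfl | rfl
    · exact D.vertex e he f hf v hve hvf
    · exact old_new hma e he v hve hvf
    · exact old_new hmb e he v hve hvf
    · exact new_old ha hma f hf v hve hvf
    · exact hve
    · exact new_new ha hmb v hve hvf
    · exact new_old hb hmb f hf v hve hvf
    · exact new_new hb hma v hve hvf
    · exact hve
  no_triple := by
    have new_new_old : ∀ x, x ∈ seg s(a, m) → x ∈ seg s(b, m) → ∀ e ∈ D.edges, x ∉ seg e := by
      intro x hxa hxb e he hxe
      rw [eq_of_mem_seg_of_mem_seg hab hm hxa hxb] at hxe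
      exact hma.notMem_seg he hxe
    intro x e he f hf g hg hxe hxf hxg
    simp only [Finset.mem_union, Finset.mem_insert, Finset.mem_singleton] at he hf hg
    rcases he with he | rfl | rfl <;> rcases hf with hf | rfl | rfl <;>
      rcases hg with hg | rfl | rfl
    · exact D.no_triple x e he f hf g hg hxe hxf hxg
    · exact Or.inl (eq_of_mem_seg_of_genericFrom ha hma he hf hxe hxf hxg)
    · exact Or.inl (eq_of_mem_seg_of_genericFrom hb hmb he hf hxe hxf hxg)
    · exact Or.inr (Or.inr (eq_of_mem_seg_of_genericFrom ha hma he hg hxe hxg hxf))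
    · exact Or.inr (Or.inl rfl)
    · exact absurd hxe (new_new_old x hxf hxg e he)
    · exact Or.inr (Or.inr (eq_of_mem_seg_of_genericFrom hb hmb he hg hxe hxg hxf))
    · exact absurd hxe (new_new_old x hxg hxf e he)
    · exact Or.inr (Or.inl rfl)
    · exact Or.inr (Or.inl (eq_of_mem_seg_of_genericFrom ha hma hf hg hxf hxg hxe))
    · exact Or.inr (Or.inr rfl)
    · exact absurd hxf (new_new_old x hxe hxg f hf)
    · exact Or.inl rfl
    · exact Or.inl rfl
    · exact Or.inl rfl
    · exact absurd hxg (new_new_old x hxe hxf g hg)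
    · exact Or.inr (Or.inr rfl)
    · exact Or.inr (Or.inl rfl)
    · exact Or.inr (Or.inl (eq_of_mem_seg_of_genericFrom hb hmb hf hg hxf hxg hxe))
    · exact absurd hxf (new_new_old x hxg hxe f hf)
    · exact Or.inr (Or.inr rfl)
    · exact absurd hxg (new_new_old x hxf hxe g hg)
    · exact Or.inr (Or.inl rfl)
    · exact Or.inr (Or.inr rfl)
    · exact Or.inl rfl
    · exact Or.inl rfl
    · exact Or.inl rfl
  above := D.above
  above_crosses e f h := by
    obtain ⟨he, hf, hc⟩ := D.above_crosses e f h
    exact ⟨Finset.mem_union_left _ he, Finset.mem_union_left _ hf, hc⟩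
  above_asymm := D.above_asymm

/-- Removal of edges without classical crossings. -/
def restrict (D : Diagram) (E : Finset (Sym2 S2)) (hE : E ⊆ D.edges)
    (h : ∀ e f, D.above e f → e ∈ E ∧ f ∈ E) : Diagram where
  edges := E
  short a b hab := D.short a b (hE hab)
  vertex e he f hf := D.vertex e (hE he) f (hE hf)
  no_triple x e he f hf g hg := D.no_triple x e (hE he) f (hE hf) g (hE hg)
  above := D.above
  above_crosses e f hef := ⟨(h e f hef).1, (h e f hef).2, (D.above_crosses e f hef).2.2⟩
  above_asymm := D.above_asymm

end Diagram

/-! ### Polygonal arcs -/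

lemma SimpleGraph.Walk.IsPath.exists_two_edges {V : Type*} {G : SimpleGraph V} {a b v : V}
    {w : G.Walk a b} (hw : w.IsPath) (hv : v ∈ w.support) (ha : v ≠ a) (hb : v ≠ b) :
    ∃ e ∈ w.edges, ∃ f ∈ w.edges, e ≠ f ∧ v ∈ e ∧ v ∈ f := by
  induction w with
  | nil => exact absurd (by simpa using hv) ha
  | cons h p ih =>
    rename_i u u' u''
    rw [SimpleGraph.Walk.cons_isPath_iff] at hw
    have hvp : v ∈ p.support := by simpa [ha] using hv
    by_cases hvu : v = u'
    · subst hvu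
      cases p with
      | nil => exact absurd rfl hb
      | cons h' p' =>
        rename_i u'
        refine ⟨s(u, v), by simp, s(v, u'), by simp, fun heq => hw.2 ?_, by simp, by simp⟩
        have : u ∈ s(v, u') := heq ▸ Sym2.mem_mk_left u v
        rcases Sym2.mem_iff.mp this with rfl | rfl <;> simp
    · obtain ⟨e, he, f, hf, hef⟩ := ih hw.1 hvp hvu hb
      exact ⟨e, by simp [he], f, by simp [hf], hef⟩

namespace IsPolygonalArc

variable {P : Finset (Sym2 S2)} {a b : S2}

lemma symm (h : IsPolygonalArc P a b) : IsPolygonalArc P b a := by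
  obtain ⟨w, hw, rfl⟩ := h
  exact ⟨w.reverse, hw.reverse, by ext; simp⟩

lemma exists_mem_left (h : IsPolygonalArc P a b) (hab : a ≠ b) : ∃ e ∈ P, a ∈ e := by
  obtain ⟨w, hw, rfl⟩ := h
  cases w with
  | nil => exact absurd rfl hab
  | cons h p =>
    rename_i u
    exact ⟨s(a, u), by simp, Sym2.mem_mk_left _ _⟩

lemma exists_ne_of_mem (h : IsPolygonalArc P a b) {e : Sym2 S2} (he : e ∈ P) {v : S2} (hv : v ∈ e)
    (ha : v ≠ a) (hb : v ≠ b) : ∃ f ∈ P, f ≠ e ∧ v ∈ f := by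
  obtain ⟨w, hw, rfl⟩ := h
  obtain ⟨f, hf, g, hg, hfg, hvf, hvg⟩ := hw.exists_two_edges
    (SimpleGraph.Walk.mem_support_of_mem_edges (by simpa using he) hv) ha hb
  by_cases hfe : f = e
  · exact ⟨g, by simpa using hg, fun hge => hfg (hfe.trans hge.symm), hvg⟩
  · exact ⟨f, by simpa using hf, hfe, hvf⟩

lemma cons (h : IsPolygonalArc P a b) {c : S2} (hca : c ≠ a) (hcb : c ≠ b)
    (hc : ∀ e ∈ P, c ∉ e) : IsPolygonalArc (insert s(c, a) P) c b := by
  obtain ⟨w, hw, rfl⟩ := h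
  refine ⟨SimpleGraph.Walk.cons (by simpa using hca) w, ?_, by ext; simp⟩
  rw [SimpleGraph.Walk.cons_isPath_iff]
  refine ⟨hw, fun hmem => ?_⟩
  rcases SimpleGraph.Walk.mem_support_iff_exists_mem_edges.mp hmem with rfl | ⟨e, he, hce⟩
  · exact hcb rfl
  · exact hc e (by simpa using he) hce

lemma pair {m : S2} (ha : a ≠ m) (hb : b ≠ m) (hab : a ≠ b) :
    IsPolygonalArc {s(a, m), s(b, m)} a b := by
  have h : IsPolygonalArc ∅ b b := ⟨SimpleGraph.Walk.nil, by simp, by simp⟩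
  have h1 : IsPolygonalArc (insert s(m, b) ∅) m b :=
    cons h hb.symm hb.symm (by simp)
  have h2 := cons h1 ha hab (by simp [hab, ha])
  rwa [Sym2.eq_swap (a := m)] at h2

end IsPolygonalArc

/-! ### Partial closures -/

variable {n : ℕ} {τ σ : Equiv.Perm (Fin (2 * n))}

lemma IsClosurePerm.apply_apply (hσ : IsClosurePerm σ) (i : Fin (2 * n)) : σ (σ i) = i := by
  have := congrArg (fun π : Equiv.Perm (Fin (2 * n)) => π i) hσ.1
  simpa [pow_two] using this

/-- `D` consists of `L` and of the closure arcs `P i` at the ends with labels in `t`. -/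
structure IsPartialClosure (σ : Equiv.Perm (Fin (2 * n))) (L : LinkoidDiagram n τ)
    (t : Finset (Fin (2 * n))) (P : Fin (2 * n) → Finset (Sym2 S2)) (D : Diagram) : Prop where
  closed : ∀ i ∈ t, σ i ∈ t
  arc : ∀ i ∈ t, IsPolygonalArc (P i) (L.endpt i) (L.endpt (σ i))
  symm : ∀ i ∈ t, P (σ i) = P i
  disjoint_left : ∀ i ∈ t, Disjoint L.edges (P i)
  disjoint : ∀ i ∈ t, ∀ j ∈ t, j ≠ i → j ≠ σ i → Disjoint (P i) (P j)
  edges_eq : D.edges = L.edges ∪ t.biUnion P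
  above_iff : ∀ e f, D.above e f ↔ L.above e f

/-- The arcs `P` with those at the ends `i` and `σ i` replaced by `Q`. -/
def updateArc (σ : Equiv.Perm (Fin (2 * n))) (P : Fin (2 * n) → Finset (Sym2 S2))
    (i : Fin (2 * n)) (Q : Finset (Sym2 S2)) : Fin (2 * n) → Finset (Sym2 S2) :=
  fun j => if j = i ∨ j = σ i then Q else P j

lemma isVirtualClosure_iff {L : LinkoidDiagram n τ} {D : VirtualLinkDiagram} :
    IsVirtualClosure σ L D ↔ ∃ P, IsPartialClosure σ L Finset.univ P D.toDiagram := by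
  constructor
  · rintro ⟨P, h1, h2, h3, h4, h5, h6⟩
    exact ⟨P, ⟨fun _ _ => Finset.mem_univ _, fun i _ => h1 i, fun i _ => h2 i, fun i _ => h3 i,
      fun i _ j _ => h4 i j, h5, h6⟩⟩
  · rintro ⟨P, h⟩
    exact ⟨P, fun i => h.arc i (Finset.mem_univ i), fun i => h.symm i (Finset.mem_univ i),
      fun i => h.disjoint_left i (Finset.mem_univ i),
      fun i j => h.disjoint i (Finset.mem_univ i) j (Finset.mem_univ j), h.edges_eq, h.above_iff⟩

namespace LinkoidDiagram

lemma isEndpoint_endpt (L : LinkoidDiagram n τ) (i : Fin (2 * n)) : L.IsEndpoint (L.endpt i) :=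
  (L.isEndpoint_iff _).mpr ⟨i, rfl⟩

lemma endpt_ne (L : LinkoidDiagram n τ) (hσ : IsClosurePerm σ) (i : Fin (2 * n)) :
    L.endpt i ≠ L.endpt (σ i) :=
  fun h => hσ.2 i (L.endpt_injective h).symm

end LinkoidDiagram

namespace IsPartialClosure

variable {L : LinkoidDiagram n τ} {t : Finset (Fin (2 * n))} {P : Fin (2 * n) → Finset (Sym2 S2)}
  {D : Diagram}

lemma mem_of_mem_edges (h : IsPartialClosure σ L t P D) {e : Sym2 S2} (he : e ∈ L.edges) :
    e ∈ D.edges := by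
  rw [h.edges_eq]
  exact Finset.mem_union_left _ he

lemma mem_of_mem_arc (h : IsPartialClosure σ L t P D) {i : Fin (2 * n)} (hi : i ∈ t)
    {e : Sym2 S2} (he : e ∈ P i) : e ∈ D.edges := by
  rw [h.edges_eq]
  exact Finset.mem_union_right _ (Finset.mem_biUnion.mpr ⟨i, hi, he⟩)

lemma ne_of_mem (h : IsPartialClosure σ L t P D) {i : Fin (2 * n)} (hi : i ∈ t) {e f : Sym2 S2}
    (he : e ∈ L.edges) (hf : f ∈ P i) : e ≠ f :=
  fun hef => Finset.disjoint_left.mp (h.disjoint_left i hi) he (hef ▸ hf)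

/-- The vertices on a closure arc, other than its ends, are not on the linkoid diagram. -/
lemma eq_or_eq_of_mem (h : IsPartialClosure σ L t P D) {i : Fin (2 * n)} (hi : i ∈ t)
    {e f : Sym2 S2} {v : S2} (he : e ∈ L.edges) (hve : v ∈ e) (hf : f ∈ P i) (hvf : v ∈ f) :
    v = L.endpt i ∨ v = L.endpt (σ i) := by
  by_contra! hne
  obtain ⟨g, hg, hgf, hvg⟩ := (h.arc i hi).exists_ne_of_mem hf hvf hne.1 hne.2
  rcases D.eq_or_eq_or_eq_of_mem (h.mem_of_mem_edges he) (h.mem_of_mem_arc hi hf)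
    (h.mem_of_mem_arc hi hg) hve hvf hvg with h1 | h1 | h1
  · exact h.ne_of_mem hi he hf h1
  · exact hgf h1.symm
  · exact h.ne_of_mem hi he hg h1

lemma exists_mem_arc (h : IsPartialClosure σ L t P D) (hσ : IsClosurePerm σ) {i : Fin (2 * n)}
    (hi : i ∈ t) : ∃ e ∈ P i, L.endpt i ∈ e :=
  (h.arc i hi).exists_mem_left (L.endpt_ne hσ i)

lemma isEndpoint_iff (h : IsPartialClosure σ L t P D) (hσ : IsClosurePerm σ) (v : S2) :
    D.IsEndpoint v ↔ ∃ i ∉ t, v = L.endpt i := by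
  constructor
  · rintro hv
    obtain ⟨e, ⟨he, hve⟩, -⟩ := id hv
    rw [h.edges_eq] at he
    rcases Finset.mem_union.mp he with heL | heP
    · obtain ⟨i, rfl⟩ : v ∈ Set.range L.endpt := (L.isEndpoint_iff v).mp
        ⟨e, ⟨heL, hve⟩, fun f hf => hv.eq (h.mem_of_mem_edges hf.1) hf.2
          (h.mem_of_mem_edges heL) hve⟩
      refine ⟨i, fun hi => ?_, rfl⟩
      obtain ⟨f, hf, hvf⟩ := h.exists_mem_arc hσ hi
      exact h.ne_of_mem hi heL hf
        (hv.eq (h.mem_of_mem_edges heL) hve (h.mem_of_mem_arc hi hf) hvf)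
    · exfalso
      obtain ⟨i, hi, heP⟩ := Finset.mem_biUnion.mp heP
      have key : ∀ j, v ≠ L.endpt j := by
        rintro j rfl
        obtain ⟨f, ⟨hf, hvf⟩, -⟩ := L.isEndpoint_endpt j
        exact h.ne_of_mem hi hf heP
          (hv.eq (h.mem_of_mem_edges hf) hvf (h.mem_of_mem_arc hi heP) hve)
      obtain ⟨g, hg, hge, hvg⟩ := (h.arc i hi).exists_ne_of_mem heP hve (key i) (key (σ i))
      exact hge (hv.eq (h.mem_of_mem_arc hi hg) hvg (h.mem_of_mem_arc hi heP) hve)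
  · rintro ⟨i, hi, rfl⟩
    have hL := L.isEndpoint_endpt i
    obtain ⟨e, ⟨he, hve⟩, huniq⟩ := id hL
    refine ⟨e, ⟨h.mem_of_mem_edges he, hve⟩, ?_⟩
    rintro f ⟨hf, hvf⟩
    rw [h.edges_eq] at hf
    rcases Finset.mem_union.mp hf with hfL | hfP
    · exact huniq f ⟨hfL, hvf⟩
    · exfalso
      obtain ⟨j, hj, hfP⟩ := Finset.mem_biUnion.mp hfP
      rcases h.eq_or_eq_of_mem hj he hve hfP hvf with h1 | h1
      · exact hi (L.endpt_injective h1 ▸ hj)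
      · exact hi (L.endpt_injective h1 ▸ h.closed j hj)

/-- A diagram in which all ends are joined by closure arcs is closed. -/
def toVirtualLinkDiagram (h : IsPartialClosure σ L Finset.univ P D) (hσ : IsClosurePerm σ) :
    VirtualLinkDiagram where
  toDiagram := D
  closed v hv := by
    obtain ⟨i, hi, -⟩ := (h.isEndpoint_iff hσ v).mp hv
    exact hi (Finset.mem_univ i)

lemma empty (σ : Equiv.Perm (Fin (2 * n))) (L : LinkoidDiagram n τ)
    (P : Fin (2 * n) → Finset (Sym2 S2)) : IsPartialClosure σ L ∅ P L.toDiagram := by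
  constructor <;> simp

/-- Removal of one closure arc. -/
lemma exists_erase (h : IsPartialClosure σ L t P D) (hσ : IsClosurePerm σ) (i : Fin (2 * n)) :
    ∃ D', IsPartialClosure σ L (t \ {i, σ i}) P D' := by
  have hsub : t \ {i, σ i} ⊆ t := Finset.sdiff_subset
  refine ⟨D.restrict (L.edges ∪ (t \ {i, σ i}).biUnion P) ?_ ?_, ?_⟩
  · rw [h.edges_eq]
    exact Finset.union_subset_union_right (Finset.biUnion_subset_biUnion_of_subset_left P hsub)
  · intro e f hef
    have := L.above_crosses e f ((h.above_iff e f).mp hef)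
    exact ⟨Finset.mem_union_left _ this.1, Finset.mem_union_left _ this.2.1⟩
  · refine ⟨?_, fun j hj => h.arc j (hsub hj), fun j hj => h.symm j (hsub hj),
      fun j hj => h.disjoint_left j (hsub hj),
      fun j hj k hk => h.disjoint j (hsub hj) k (hsub hk), rfl, h.above_iff⟩
    intro j hj
    simp only [Finset.mem_sdiff, Finset.mem_insert, Finset.mem_singleton, not_or] at hj ⊢
    refine ⟨h.closed j hj.1, fun h1 => hj.2.2 ?_, fun h1 => hj.2.1 (σ.injective h1)⟩
    rw [← h1, hσ.apply_apply]

/-- Addition of one closure arc with a generic vertex `m`. -/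
lemma exists_insert (h : IsPartialClosure σ L t P D) (hσ : IsClosurePerm σ) {i : Fin (2 * n)}
    (hi : i ∉ t) {m : S2} (hma : GenericFrom D.edges (L.endpt i) m)
    (hmb : GenericFrom D.edges (L.endpt (σ i)) m)
    (hm : (m : EuclideanSpace ℝ (Fin 3)) ∉ Submodule.span ℝ
      {(L.endpt i : EuclideanSpace ℝ (Fin 3)), (L.endpt (σ i) : EuclideanSpace ℝ (Fin 3))}) :
    ∃ D', IsPartialClosure σ L (t ∪ {i, σ i})
      (updateArc σ P i {s(L.endpt i, m), s(L.endpt (σ i), m)}) D' := by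
  have hi' : σ i ∉ t := fun h' => hi (hσ.apply_apply i ▸ h.closed _ h')
  have ha : D.IsEndpoint (L.endpt i) := (h.isEndpoint_iff hσ _).mpr ⟨i, hi, rfl⟩
  have hb : D.IsEndpoint (L.endpt (σ i)) := (h.isEndpoint_iff hσ _).mpr ⟨σ i, hi', rfl⟩
  have hab := L.endpt_ne hσ i
  have harc := IsPolygonalArc.pair (Diagram.ne_of_genericFrom ha hma)
    (Diagram.ne_of_genericFrom hb hmb) hab
  set Q : Finset (Sym2 S2) := {s(L.endpt i, m), s(L.endpt (σ i), m)} with hQ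
  have hQD : ∀ e ∈ Q, e ∉ D.edges := by
    intro e he heD
    refine hma.notMem_of_mem heD ?_
    simp only [hQ, Finset.mem_insert, Finset.mem_singleton] at he
    rcases he with rfl | rfl <;> simp
  have hold : ∀ j ∈ t, updateArc σ P i Q j = P j := by
    intro j hj
    refine if_neg ?_
    rintro (rfl | rfl)
    · exact hi hj
    · exact hi' hj
  have hnew : updateArc σ P i Q i = Q := if_pos (Or.inl rfl)
  have hnew' : updateArc σ P i Q (σ i) = Q := if_pos (Or.inr rfl)
  have hcase : ∀ j ∈ t ∪ {i, σ i}, j ∈ t ∨ j = i ∨ j = σ i := by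
    intro j hj
    rw [Finset.mem_union, Finset.mem_insert, Finset.mem_singleton] at hj
    exact hj
  refine ⟨D.addArc ha hb hab hma hmb hm, ?_, ?_, ?_, ?_, ?_, ?_, h.above_iff⟩
  · intro j hj
    rcases hcase j hj with hj | rfl | rfl
    · simp [h.closed j hj]
    · simp
    · simp [hσ.apply_apply]
  · intro j hj
    rcases hcase j hj with hj | rfl | rfl
    · rw [hold j hj]
      exact h.arc j hj
    · rwa [hnew]
    · rw [hnew', hσ.apply_apply]
      exact harc.symm
  · intro j hj
    rcases hcase j hj with hj | rfl | rfl
    · rw [hold j hj, hold _ (h.closed j hj), h.symm j hj]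
    · rw [hnew, hnew']
    · rw [hσ.apply_apply, hnew, hnew']
  · have : Disjoint L.edges Q :=
      Finset.disjoint_left.mpr fun e he heQ => hQD e heQ (h.mem_of_mem_edges he)
    intro j hj
    rcases hcase j hj with hj | rfl | rfl
    · rw [hold j hj]
      exact h.disjoint_left j hj
    · rwa [hnew]
    · rwa [hnew']
  · have hPQ : ∀ j ∈ t, Disjoint (P j) Q := fun j hj =>
      Finset.disjoint_left.mpr fun e he heQ => hQD e heQ (h.mem_of_mem_arc hj he)
    intro j hj k hk hkj hkj'
    rcases hcase j hj with hjt | rfl | rfl <;> rcases hcase k hk with hkt | rfl | rfl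
    · rw [hold j hjt, hold k hkt]
      exact h.disjoint j hjt k hkt hkj hkj'
    · rw [hold j hjt, hnew]
      exact hPQ j hjt
    · rw [hold j hjt, hnew']
      exact hPQ j hjt
    · rw [hold k hkt, hnew]
      exact (hPQ k hkt).symm
    · exact absurd rfl hkj
    · exact absurd rfl hkj'
    · rw [hold k hkt, hnew']
      exact (hPQ k hkt).symm
    · exact absurd (hσ.apply_apply _).symm hkj'
    · exact absurd rfl hkj
  · change D.edges ∪ Q = _
    rw [h.edges_eq, Finset.union_biUnion, Finset.union_assoc, Finset.biUnion_congr rfl hold]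
    congr 2
    simp [hnew, hnew']

end IsPartialClosure

lemma exists_isPartialClosure (hσ : IsClosurePerm σ) (L : LinkoidDiagram n τ)
    (s : Finset (Fin (2 * n))) : ∃ t P D, s ⊆ t ∧ IsPartialClosure σ L t P D := by
  induction s using Finset.induction_on with
  | empty => exact ⟨∅, fun _ => ∅, L.toDiagram, subset_rfl, IsPartialClosure.empty σ L _⟩
  | insert i s _ ih =>
    obtain ⟨t, P, D, hst, h⟩ := ih
    by_cases hi : i ∈ t
    · exact ⟨t, P, D, Finset.insert_subset hi hst, h⟩
    · obtain ⟨m, -, hma, hmb, hm⟩ := exists_genericFrom D.edges (L.endpt i) (L.endpt (σ i))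
        isOpen_univ Set.univ_nonempty (fun _ _ _ _ => Set.mem_univ _)
      obtain ⟨D', h'⟩ := h.exists_insert hσ hi hma hmb hm
      refine ⟨_, _, D', Finset.insert_subset (by simp) ?_, h'⟩
      exact hst.trans Finset.subset_union_left

/-- Every linkoid diagram has a virtual closure diagram. -/
lemma exists_isVirtualClosure (hσ : IsClosurePerm σ) (L : LinkoidDiagram n τ) :
    ∃ D, IsVirtualClosure σ L D := by
  obtain ⟨t, P, D, ht, h⟩ := exists_isPartialClosure hσ L Finset.univ
  obtain rfl := Finset.univ_subset_iff.mp ht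
  exact ⟨h.toVirtualLinkDiagram hσ, isVirtualClosure_iff.mpr ⟨P, h⟩⟩

/-- A closure arc can be replaced, by a detour move, by one with a generic vertex. -/
lemma exists_detour (hσ : IsClosurePerm σ) {L : LinkoidDiagram n τ}
    {P : Fin (2 * n) → Finset (Sym2 S2)} {D : VirtualLinkDiagram}
    (h : IsPartialClosure σ L Finset.univ P D.toDiagram) {i : Fin (2 * n)} {m : S2}
    (hma : GenericFrom D.edges (L.endpt i) m) (hmb : GenericFrom D.edges (L.endpt (σ i)) m)
    (hm : (m : EuclideanSpace ℝ (Fin 3)) ∉ Submodule.span ℝ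
      {(L.endpt i : EuclideanSpace ℝ (Fin 3)), (L.endpt (σ i) : EuclideanSpace ℝ (Fin 3))}) :
    ∃ D' : VirtualLinkDiagram, VirtualLinkDiagram.Detour D D' ∧ IsPartialClosure σ L Finset.univ
      (updateArc σ P i {s(L.endpt i, m), s(L.endpt (σ i), m)}) D'.toDiagram := by
  obtain ⟨R, hR⟩ := h.exists_erase hσ i
  have hRD : R.edges ⊆ D.edges := by
    rw [hR.edges_eq, h.edges_eq]
    exact Finset.union_subset_union_right
      (Finset.biUnion_subset_biUnion_of_subset_left P Finset.sdiff_subset)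
  obtain ⟨D', hD'⟩ := hR.exists_insert hσ (i := i) (by simp) (hma.mono hRD) (hmb.mono hRD) hm
  rw [Finset.sdiff_union_of_subset (Finset.subset_univ _)] at hD'
  have hi := Finset.mem_univ i
  set Q : Finset (Sym2 S2) := {s(L.endpt i, m), s(L.endpt (σ i), m)} with hQ
  have hnew : updateArc σ P i Q i = Q := if_pos (Or.inl rfl)
  have hnew' : updateArc σ P i Q (σ i) = Q := if_pos (Or.inr rfl)
  have hold : ∀ j ∈ Finset.univ \ {i, σ i}, updateArc σ P i Q j = P j := by
    intro j hj
    exact if_neg (by simpa using hj)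
  have hsplit : ∀ P' : Fin (2 * n) → Finset (Sym2 S2), P' (σ i) = P' i →
      L.edges ∪ Finset.univ.biUnion P' =
        (L.edges ∪ (Finset.univ \ {i, σ i}).biUnion P') ∪ P' i := by
    intro P' hP'
    rw [Finset.union_assoc]
    congr 1
    conv_lhs => rw [← Finset.sdiff_union_of_subset (Finset.subset_univ {i, σ i})]
    rw [Finset.union_biUnion]
    congr 1
    simp [hP']
  have hdisj : ∀ {P' : Fin (2 * n) → Finset (Sym2 S2)} {D' : Diagram},
      IsPartialClosure σ L Finset.univ P' D' →
      Disjoint (L.edges ∪ (Finset.univ \ {i, σ i}).biUnion P') (P' i) := by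
    intro P' D' h'
    rw [Finset.disjoint_union_left, Finset.disjoint_biUnion_left]
    refine ⟨h'.disjoint_left i hi, fun j hj => ?_⟩
    simp only [Finset.mem_sdiff, Finset.mem_insert, Finset.mem_singleton, not_or] at hj
    exact (h'.disjoint i hi j hj.1 hj.2.1 hj.2.2).symm
  have hclass : ∀ {P' : Fin (2 * n) → Finset (Sym2 S2)} {D' : Diagram},
      IsPartialClosure σ L Finset.univ P' D' → ∀ e ∈ P' i, ∀ f, ¬ D'.Classical e f := by
    intro P' D' h' e he f hef
    rcases hef with hef | hef
    · exact h'.ne_of_mem hi (L.above_crosses e f ((h'.above_iff _ _).mp hef)).1 he rfl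
    · exact h'.ne_of_mem hi (L.above_crosses f e ((h'.above_iff _ _).mp hef)).2.1 he rfl
  refine ⟨hD'.toVirtualLinkDiagram hσ, ⟨_, P i, updateArc σ P i Q i, _, _, h.arc i hi,
    hD'.arc i hi, hdisj h, ?_, ?_, ?_, hclass h, hclass hD', ?_⟩, hD'⟩
  · have := hdisj hD'
    rwa [Finset.biUnion_congr rfl hold] at this
  · rw [h.edges_eq, hsplit P (h.symm i hi)]
  · rw [← Finset.biUnion_congr rfl hold, ← hsplit _ (hnew'.trans hnew.symm)]
    exact hD'.edges_eq
  · intro e _ f _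
    exact (h.above_iff e f).trans (hD'.above_iff e f).symm

/-! ### Simultaneous choice of closure arcs -/

lemma exists_common_arcs (hσ : IsClosurePerm σ) {L L' : LinkoidDiagram n τ}
    (hend : L'.endpt = L.endpt) {U : Set (EuclideanSpace ℝ (Fin 3))} (hU : IsOpen U)
    (hne : U.Nonempty) (hcone : ∀ v ∈ U, ∀ c : ℝ, 0 < c → c • v ∈ U) {D D' : VirtualLinkDiagram}
    (h : IsVirtualClosure σ L D) (h' : IsVirtualClosure σ L' D') (s : Finset (Fin (2 * n))) :
    ∃ (P P' : Fin (2 * n) → Finset (Sym2 S2)) (D₁ D₁' : VirtualLinkDiagram),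
      D.Equivalent D₁ ∧ D'.Equivalent D₁' ∧
      IsPartialClosure σ L Finset.univ P D₁.toDiagram ∧
      IsPartialClosure σ L' Finset.univ P' D₁'.toDiagram ∧
      ∀ i ∈ s, P i = P' i ∧ ∀ e ∈ P i, ∃ (j : Fin (2 * n)) (m : S2),
        (m : EuclideanSpace ℝ (Fin 3)) ∈ U ∧ e = s(L.endpt j, m) := by
  induction s using Finset.induction_on with
  | empty =>
    obtain ⟨P, hP⟩ := isVirtualClosure_iff.mp h
    obtain ⟨P', hP'⟩ := isVirtualClosure_iff.mp h'
    exact ⟨P, P', D, D', Relation.EqvGen.refl D, Relation.EqvGen.refl D', hP, hP', by simp⟩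
  | insert i s _ ih =>
    obtain ⟨P, P', D₁, D₁', hD, hD', hP, hP', hs⟩ := ih
    obtain ⟨m, hmU, hma, hmb, hm⟩ := exists_genericFrom (D₁.edges ∪ D₁'.edges) (L.endpt i)
      (L.endpt (σ i)) hU hne hcone
    obtain ⟨D₂, hdet, hP₂⟩ := exists_detour hσ hP (hma.mono Finset.subset_union_left)
      (hmb.mono Finset.subset_union_left) hm
    have hright : D₁'.edges ⊆ D₁.edges ∪ D₁'.edges := Finset.subset_union_right
    rw [← hend] at hma hmb hm
    obtain ⟨D₂', hdet', hP₂'⟩ := exists_detour hσ hP' (hma.mono hright) (hmb.mono hright) hm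
    rw [hend] at hP₂'
    refine ⟨_, _, D₂, D₂', hD.trans _ _ _ (Relation.EqvGen.rel _ _ (Or.inr hdet)),
      hD'.trans _ _ _ (Relation.EqvGen.rel _ _ (Or.inr hdet')), hP₂, hP₂', ?_⟩
    intro j hj
    by_cases hji : j = i ∨ j = σ i
    · simp only [updateArc, if_pos hji, true_and]
      intro e he
      simp only [Finset.mem_insert, Finset.mem_singleton] at he
      rcases he with rfl | rfl
      · exact ⟨i, m, hmU, rfl⟩
      · exact ⟨σ i, m, hmU, rfl⟩
    · simp only [updateArc, if_neg hji]
      exact hs j ((Finset.mem_insert.mp hj).resolve_left fun h => hji (Or.inl h))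

lemma exists_common_closure (hσ : IsClosurePerm σ) {L L' : LinkoidDiagram n τ}
    (hend : L'.endpt = L.endpt) {U : Set (EuclideanSpace ℝ (Fin 3))} (hU : IsOpen U)
    (hne : U.Nonempty) (hcone : ∀ v ∈ U, ∀ c : ℝ, 0 < c → c • v ∈ U) {D D' : VirtualLinkDiagram}
    (h : IsVirtualClosure σ L D) (h' : IsVirtualClosure σ L' D') :
    ∃ (P : Fin (2 * n) → Finset (Sym2 S2)) (D₁ D₁' : VirtualLinkDiagram),
      D.Equivalent D₁ ∧ D'.Equivalent D₁' ∧
      IsPartialClosure σ L Finset.univ P D₁.toDiagram ∧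
      IsPartialClosure σ L' Finset.univ P D₁'.toDiagram ∧
      ∀ i, ∀ e ∈ P i, ∃ (j : Fin (2 * n)) (m : S2),
        (m : EuclideanSpace ℝ (Fin 3)) ∈ U ∧ e = s(L.endpt j, m) := by
  obtain ⟨P, P', D₁, D₁', hD, hD', hP, hP', hs⟩ :=
    exists_common_arcs hσ hend hU hne hcone h h' Finset.univ
  obtain rfl : P = P' := funext fun i => (hs i (Finset.mem_univ i)).1
  exact ⟨P, D₁, D₁', hD, hD', hP, hP', fun i => (hs i (Finset.mem_univ i)).2⟩

/-- The virtual closure does not depend on the choice of the closure arcs. -/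
lemma IsVirtualClosure.equivalent (hσ : IsClosurePerm σ) {L : LinkoidDiagram n τ}
    {D D' : VirtualLinkDiagram} (h : IsVirtualClosure σ L D) (h' : IsVirtualClosure σ L D') :
    D.Equivalent D' := by
  obtain ⟨P, D₁, D₁', hD, hD', hP, hP', -⟩ := exists_common_closure hσ rfl isOpen_univ
    Set.univ_nonempty (fun _ _ _ _ => Set.mem_univ _) h h'
  have heq : D₁ = D₁' := by
    have hedges := hP.edges_eq.trans hP'.edges_eq.symm
    have habove : D₁.above = D₁'.above := by
      ext e f
      exact (hP.above_iff e f).trans (hP'.above_iff e f).symm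
    obtain ⟨⟨_, _, _, _, _, _, _⟩, _⟩ := D₁
    obtain ⟨⟨_, _, _, _, _, _, _⟩, _⟩ := D₁'
    simp only at hedges habove
    subst hedges habove
    rfl
  subst heq
  exact hD.trans _ _ _ (hD'.symm _ _)

/-! ### Arcs that avoid a triangle -/

lemma exists_cone_disjoint_triangle {a b c : S2} (h : LinearIndependent ℝ
    ![(a : EuclideanSpace ℝ (Fin 3)), (b : EuclideanSpace ℝ (Fin 3)),
      (c : EuclideanSpace ℝ (Fin 3))]) :
    ∃ U : Set (EuclideanSpace ℝ (Fin 3)), IsOpen U ∧ U.Nonempty ∧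
      (∀ v ∈ U, ∀ c : ℝ, 0 < c → c • v ∈ U) ∧
      ∀ x m : S2, x ∉ triangle a b c → (m : EuclideanSpace ℝ (Fin 3)) ∈ U →
        Disjoint (seg s(x, m)) (triangle a b c) := by
  let B := basisOfLinearIndependentOfCardEqFinrank h (by simp)
  have hB : ⇑B = ![(a : EuclideanSpace ℝ (Fin 3)), (b : EuclideanSpace ℝ (Fin 3)),
      (c : EuclideanSpace ℝ (Fin 3))] := coe_basisOfLinearIndependentOfCardEqFinrank h (by simp)
  have hB0 : (a : EuclideanSpace ℝ (Fin 3)) = B 0 := by simp [hB]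
  have hB1 : (b : EuclideanSpace ℝ (Fin 3)) = B 1 := by simp [hB]
  have hB2 : (c : EuclideanSpace ℝ (Fin 3)) = B 2 := by simp [hB]
  have htri : ∀ x : S2, x ∈ triangle a b c ↔ ∀ i, 0 ≤ B.coord i x := by
    intro x
    constructor
    · intro hx i
      obtain ⟨α, β, γ, hα, hβ, hγ, hx⟩ := exists_of_mem_triangle hx
      rw [← hx, hB0, hB1, hB2]
      fin_cases i <;> simpa [Finsupp.single_apply]
    · intro hx
      refine mem_triangle_of_nonneg (hx 0) (hx 1) (hx 2) ?_
      conv_rhs => rw [← B.sum_repr (x : EuclideanSpace ℝ (Fin 3))]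
      rw [Fin.sum_univ_three, hB0, hB1, hB2]
      rfl
  refine ⟨{v | ∀ i, B.coord i v < 0}, ?_, ⟨-(B 0 + B 1 + B 2), ?_⟩, ?_, ?_⟩
  · have : {v | ∀ i, B.coord i v < 0} = ⋂ i, {v | B.coord i v < 0} := by
      ext v
      simp
    rw [this]
    exact isOpen_iInter_of_finite fun i => isOpen_lt
      (LinearMap.continuous_of_finiteDimensional (B.coord i)) continuous_const
  · intro i
    fin_cases i <;> simp
  · intro v hv c hc i
    rw [map_smul, smul_eq_mul]
    exact mul_neg_of_pos_of_neg hc (hv i)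
  · intro x m hx hm
    rw [htri] at hx
    push Not at hx
    obtain ⟨i, hi⟩ := hx
    refine Set.disjoint_left.mpr fun y hy hyt => ?_
    obtain ⟨s, t, hs, ht, hst⟩ := mem_seg_iff.mp hy
    have h1 := (htri y).mp hyt i
    rw [← hst, map_add, map_smul, map_smul, smul_eq_mul, smul_eq_mul] at h1
    have h2 := hm i
    have hs0 : s = 0 := by nlinarith
    have ht0 : t = 0 := by nlinarith
    apply S2.coe_ne_zero y
    rw [← hst, hs0, ht0]
    simp

/-! ### Invariance under the moves -/

section Lift

variable {L L' : LinkoidDiagram n τ} {P : Fin (2 * n) → Finset (Sym2 S2)} {D D' : Diagram}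
  {a b c : S2} {K : Set (Sym2 S2)}

lemma IsPartialClosure.notMem_edges (h : IsPartialClosure σ L Finset.univ P D)
    (h' : IsPartialClosure σ L' Finset.univ P D') {e : Sym2 S2} (he : e ∈ D.edges)
    (heL : e ∉ L.edges) : e ∉ L'.edges := by
  rw [h.edges_eq] at he
  obtain ⟨i, hi, he⟩ := Finset.mem_biUnion.mp ((Finset.mem_union.mp he).resolve_left heL)
  exact fun heL' => h'.ne_of_mem hi heL' he rfl

lemma Diagram.Replaces.virtualClosure (hr : L.Replaces L'.toDiagram a b c)
    (h : IsPartialClosure σ L Finset.univ P D) (h' : IsPartialClosure σ L' Finset.univ P D') :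
    D.Replaces D' a b c where
  mem := h.mem_of_mem_edges hr.mem
  left_notMem hm := h.notMem_edges h' hm hr.left_notMem (by rw [hr.edges_eq]; simp)
  right_notMem hm := h.notMem_edges h' hm hr.right_notMem (by rw [hr.edges_eq]; simp)
  edges_eq := by
    have hab : s(a, b) ∉ Finset.univ.biUnion P := by
      intro hm
      obtain ⟨i, hi, hm⟩ := Finset.mem_biUnion.mp hm
      exact h.ne_of_mem hi hr.mem hm rfl
    rw [h'.edges_eq, h.edges_eq, hr.edges_eq, Finset.erase_union_distrib,
      Finset.erase_eq_of_notMem hab, Finset.insert_union, Finset.insert_union]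
  above_iff e he f hf hea hfa := by
    rw [h.above_iff, h'.above_iff]
    by_cases heL : e ∈ L.edges
    · by_cases hfL : f ∈ L.edges
      · exact hr.above_iff e heL f hfL hea hfa
      · exact iff_of_false (fun hef => hfL (L.above_crosses e f hef).2.1)
          (fun hef => h.notMem_edges h' hf hfL (L'.above_crosses e f hef).2.1)
    · exact iff_of_false (fun hef => heL (L.above_crosses e f hef).1)
        (fun hef => h.notMem_edges h' he heL (L'.above_crosses e f hef).1)

lemma Diagram.Subdivides.virtualClosure (hs : L.Subdivides L'.toDiagram a b c)
    (h : IsPartialClosure σ L Finset.univ P D) (h' : IsPartialClosure σ L' Finset.univ P D') :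
    D.Subdivides D' a b c where
  toReplaces := hs.toReplaces.virtualClosure h h'
  mem_seg := hs.mem_seg
  above_left e he hea := by
    rw [h.above_iff, h'.above_iff, h'.above_iff]
    by_cases heL : e ∈ L.edges
    · exact hs.above_left e heL hea
    · have heL' := h.notMem_edges h' he heL
      refine iff_of_false (fun hef => heL (L.above_crosses _ _ hef).2.1) ?_
      rintro (hef | hef) <;> exact heL' (L'.above_crosses _ _ hef).2.1
  above_right e he hea := by
    rw [h.above_iff, h'.above_iff, h'.above_iff]
    by_cases heL : e ∈ L.edges
    · exact hs.above_right e heL hea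
    · have heL' := h.notMem_edges h' he heL
      refine iff_of_false (fun hef => heL (L.above_crosses _ _ hef).1) ?_
      rintro (hef | hef) <;> exact heL' (L'.above_crosses _ _ hef).1

lemma Diagram.TriangleMove.virtualClosure (hσ : IsClosurePerm σ)
    (ht : L.TriangleMove L'.toDiagram a b c K) (h : IsPartialClosure σ L Finset.univ P D)
    (h' : IsPartialClosure σ L' Finset.univ P D')
    (hP : ∀ i, ∀ e ∈ P i, Disjoint (seg e) (triangle a b c)) : D.TriangleMove D' a b c K where
  toReplaces := ht.toReplaces.virtualClosure h h'
  indep := ht.indep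
  no_endpoint v _ hv := by
    obtain ⟨i, hi, -⟩ := (h.isEndpoint_iff hσ v).mp hv
    exact hi (Finset.mem_univ i)
  content e he hea heK x hxe hxt := by
    rw [h.edges_eq] at he
    rcases Finset.mem_union.mp he with he | he
    · exact ht.content e he hea heK x hxe hxt
    · obtain ⟨i, -, he⟩ := Finset.mem_biUnion.mp he
      exact absurd hxt (Set.disjoint_left.mp (hP i e he) hxe)

end Lift

lemma exists_triangleMove (hσ : IsClosurePerm σ) {L L' : LinkoidDiagram n τ}
    (hend : L'.endpt = L.endpt) {a b c : S2} {K : Set (Sym2 S2)}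
    (ht : L.TriangleMove L'.toDiagram a b c K) {D D' : VirtualLinkDiagram}
    (h : IsVirtualClosure σ L D) (h' : IsVirtualClosure σ L' D') :
    ∃ D₁ D₁' : VirtualLinkDiagram, D.Equivalent D₁ ∧ D'.Equivalent D₁' ∧
      D₁.TriangleMove D₁'.toDiagram a b c K ∧ L.edges ⊆ D₁.edges ∧
      D₁.above = L.above ∧ D₁'.above = L'.above := by
  obtain ⟨U, hU, hne, hcone, hdisj⟩ := exists_cone_disjoint_triangle ht.indep
  obtain ⟨P, D₁, D₁', hD, hD', hP, hP', hmem⟩ :=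
    exists_common_closure hσ hend hU hne hcone h h'
  refine ⟨D₁, D₁', hD, hD', ht.virtualClosure hσ hP hP' ?_, fun e he => hP.mem_of_mem_edges he,
    ?_, ?_⟩
  · intro i e he
    obtain ⟨j, m, hm, rfl⟩ := hmem i e he
    exact hdisj _ m (fun hj => ht.no_endpoint _ hj (L.isEndpoint_endpt j)) hm
  · ext e f
    exact hP.above_iff e f
  · ext e f
    exact hP'.above_iff e f

namespace Diagram

lemma classical_congr {D D' : Diagram} (h : D.above = D'.above) : D.Classical = D'.Classical := by
  unfold Classical
  rw [h]

lemma sameCrossing_congr {D D' E E' : Diagram} (h : D.above = E.above) (h' : D'.above = E'.above) :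
    D.SameCrossing D' = E.SameCrossing E' := by
  unfold SameCrossing
  rw [h, h']

lemma Traverses.mono {D D' : Diagram} {e : Sym2 S2} {a b c : S2} (h : D.Traverses e a b c)
    (hD : D.edges ⊆ D'.edges) : D'.Traverses e a b c :=
  ⟨hD h.1, h.2⟩

end Diagram

lemma equivalent_of_classicalMove (hσ : IsClosurePerm σ) {L L' : LinkoidDiagram n τ}
    (hmove : L.ClassicalMove L'.toDiagram) (hend : L'.endpt = L.endpt)
    {D D' : VirtualLinkDiagram} (h : IsVirtualClosure σ L D) (h' : IsVirtualClosure σ L' D') :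
    D.Equivalent D' := by
  suffices hs : ∃ D₁ D₁' : VirtualLinkDiagram, D.Equivalent D₁ ∧ D'.Equivalent D₁' ∧
      D₁.ClassicalMove D₁'.toDiagram by
    obtain ⟨D₁, D₁', hD, hD', hm⟩ := hs
    have hrel : D₁.Equivalent D₁' := Relation.EqvGen.rel _ _ (Or.inl hm)
    exact hD.trans _ _ _ (hrel.trans _ _ _ (hD'.symm _ _))
  cases hmove with
  | subdivide a b c hsub =>
    obtain ⟨P, D₁, D₁', hD, hD', hP, hP', -⟩ := exists_common_closure hσ hend isOpen_univ
      Set.univ_nonempty (fun _ _ _ _ => Set.mem_univ _) h h'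
    exact ⟨D₁, D₁', hD, hD', .subdivide a b c (hsub.virtualClosure hP hP')⟩
  | isotopy a b c ht =>
    obtain ⟨D₁, D₁', hD, hD', ht', hsub, ha, ha'⟩ := exists_triangleMove hσ hend ht h h'
    exact ⟨D₁, D₁', hD, hD', .isotopy a b c ht'⟩
  | isotopy_across a b c e ht trav old new type =>
    obtain ⟨D₁, D₁', hD, hD', ht', hsub, ha, ha'⟩ := exists_triangleMove hσ hend ht h h'
    rw [← Diagram.sameCrossing_congr ha ha'] at type
    exact ⟨D₁, D₁', hD, hD', .isotopy_across a b c e ht' (trav.mono hsub) old new type⟩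
  | r1 p a b c ht mem out new =>
    obtain ⟨D₁, D₁', hD, hD', ht', hsub, ha, ha'⟩ := exists_triangleMove hσ hend ht h h'
    rw [← Diagram.classical_congr ha'] at new
    exact ⟨D₁, D₁', hD, hD', .r1 p a b c ht' (hsub mem) out new⟩
  | r2 a b c e ht trav new =>
    obtain ⟨D₁, D₁', hD, hD', ht', hsub, ha, ha'⟩ := exists_triangleMove hσ hend ht h h'
    rw [← ha'] at new
    exact ⟨D₁, D₁', hD, hD', .r2 a b c e ht' (trav.mono hsub) new⟩
  | r3 a b c e f ht tl tr inside cl ol nl or nr tyl tyr ac ac' =>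
    obtain ⟨D₁, D₁', hD, hD', ht', hsub, ha, ha'⟩ := exists_triangleMove hσ hend ht h h'
    rw [← Diagram.classical_congr ha] at cl ol or
    rw [← Diagram.classical_congr ha'] at nl nr
    rw [← Diagram.sameCrossing_congr ha ha'] at tyl tyr
    rw [← ha] at ac ac'
    exact ⟨D₁, D₁', hD, hD', .r3 a b c e f ht' (tl.mono hsub) (tr.mono hsub) inside cl ol nl or nr
      tyl tyr ac ac'⟩

/-- A closure of a prolonged linkoid diagram is a closure of the linkoid diagram itself. -/
lemma LinkoidDiagram.Prolongs.isVirtualClosure (hσ : IsClosurePerm σ) {L L' : LinkoidDiagram n τ}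
    {i : Fin (2 * n)} {c : S2} (hp : L.Prolongs L' i c) {D : VirtualLinkDiagram}
    (h : IsVirtualClosure σ L' D) : IsVirtualClosure σ L D := by
  obtain ⟨P, h⟩ := isVirtualClosure_iff.mp h
  obtain ⟨hend, hc, hedges, habove⟩ := hp
  refine isVirtualClosure_iff.mpr
    ⟨updateArc σ P i (insert s(L.endpt i, c) (P i)), ?_⟩
  set Q := insert s(L.endpt i, c) (P i) with hQ
  have hu : ∀ j : Fin (2 * n), j ∈ Finset.univ := Finset.mem_univ
  have hsub : L.edges ⊆ L'.edges := by
    rw [hedges]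
    exact Finset.subset_insert _ _
  have hnewmem : s(L.endpt i, c) ∈ L'.edges := by
    rw [hedges]
    exact Finset.mem_insert_self _ _
  obtain ⟨e₀, ⟨he₀, hie₀⟩, -⟩ := L.isEndpoint_endpt i
  have hic : L.endpt i ≠ c := fun h => (hc e₀ he₀).1 (h ▸ hie₀)
  have hold : ∀ j, ¬ (j = i ∨ j = σ i) → updateArc σ P i Q j = P j := fun j hj => if_neg hj
  have hnew : ∀ j, (j = i ∨ j = σ i) → updateArc σ P i Q j = Q := fun j hj => if_pos hj
  have hswap : ∀ j, (j = i ∨ j = σ i) → (σ j = i ∨ σ j = σ i) := by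
    rintro j (rfl | rfl)
    · exact Or.inr rfl
    · exact Or.inl (hσ.apply_apply i)
  have hswap' : ∀ j, ¬ (j = i ∨ j = σ i) → ¬ (σ j = i ∨ σ j = σ i) := by
    intro j hj hj'
    have := hswap _ hj'
    rw [hσ.apply_apply] at this
    exact hj this
  have hend' : ∀ j, j ≠ i → L'.endpt j = L.endpt j := by
    intro j hj
    rw [hend, Function.update_of_ne hj]
  have harc : IsPolygonalArc Q (L.endpt i) (L.endpt (σ i)) := by
    have := h.arc i (hu i)
    rw [hend' _ (hσ.2 i), hend, Function.update_self] at this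
    refine this.cons hic (L.endpt_ne hσ i) fun e he hie => ?_
    rcases D.eq_or_eq_or_eq_of_mem (h.mem_of_mem_edges (hsub he₀)) (h.mem_of_mem_edges hnewmem)
      (h.mem_of_mem_arc (hu i) he) hie₀ (Sym2.mem_mk_left _ _) hie with h1 | h1 | h1
    · exact (hc e₀ he₀).1 (h1 ▸ Sym2.mem_mk_right _ _)
    · exact h.ne_of_mem (hu i) hnewmem he h1
    · exact h.ne_of_mem (hu i) (hsub he₀) he h1
  have hPQ : ∀ j, ¬ (j = i ∨ j = σ i) → Disjoint Q (P j) := by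
    intro j hj
    rw [hQ, Finset.disjoint_insert_left]
    exact ⟨fun hm => h.ne_of_mem (hu j) hnewmem hm rfl,
      h.disjoint i (hu i) j (hu j) (fun h => hj (Or.inl h)) (fun h => hj (Or.inr h))⟩
  refine ⟨fun _ _ => hu _, ?_, ?_, ?_, ?_, ?_, ?_⟩
  · intro j _
    by_cases hj : j = i ∨ j = σ i
    · rw [hnew j hj]
      rcases hj with rfl | rfl
      · exact harc
      · rw [hσ.apply_apply]
        exact harc.symm
    · rw [hold j hj, ← hend' j fun h => hj (Or.inl h),
        ← hend' (σ j) fun h => hswap' j hj (Or.inl h)]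
      exact h.arc j (hu j)
  · intro j _
    by_cases hj : j = i ∨ j = σ i
    · rw [hnew j hj, hnew _ (hswap j hj)]
    · rw [hold j hj, hold _ (hswap' j hj)]
      exact h.symm j (hu j)
  · intro j _
    by_cases hj : j = i ∨ j = σ i
    · rw [hnew j hj, hQ, Finset.disjoint_insert_right]
      exact ⟨fun hm => (hc _ hm).1 (Sym2.mem_mk_right _ _),
        (h.disjoint_left i (hu i)).mono_left hsub⟩
    · rw [hold j hj]
      exact (h.disjoint_left j (hu j)).mono_left hsub
  · intro j _ k _ hkj hkj'
    by_cases hj : j = i ∨ j = σ i <;> by_cases hk : k = i ∨ k = σ i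
    · exfalso
      rcases hj with rfl | rfl <;> rcases hk with rfl | rfl
      · exact hkj rfl
      · exact hkj' rfl
      · exact hkj' (hσ.apply_apply _).symm
      · exact hkj rfl
    · rw [hnew j hj, hold k hk]
      exact hPQ k hk
    · rw [hold j hj, hnew k hk]
      exact (hPQ j hj).symm
    · rw [hold j hj, hold k hk]
      exact h.disjoint j (hu j) k (hu k) hkj hkj'
  · rw [h.edges_eq, hedges]
    ext e
    simp only [Finset.mem_union, Finset.mem_insert, Finset.mem_biUnion, Finset.mem_univ, true_and]
    constructor
    · rintro ((rfl | he) | ⟨j, he⟩)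
      · exact Or.inr ⟨i, by rw [hnew i (Or.inl rfl), hQ]; simp⟩
      · exact Or.inl he
      · refine Or.inr ⟨j, ?_⟩
        by_cases hj : j = i ∨ j = σ i
        · rw [hnew j hj, hQ]
          refine Finset.mem_insert_of_mem ?_
          rcases hj with rfl | rfl
          · exact he
          · rwa [← h.symm i (hu i)]
        · rwa [hold j hj]
    · rintro (he | ⟨j, he⟩)
      · exact Or.inl (Or.inr he)
      · by_cases hj : j = i ∨ j = σ i
        · rw [hnew j hj, hQ, Finset.mem_insert] at he
          rcases he with rfl | he
          · exact Or.inl (Or.inl rfl)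
          · exact Or.inr ⟨i, he⟩
        · rw [hold j hj] at he
          exact Or.inr ⟨j, he⟩
  · intro e f
    exact (h.above_iff e f).trans (habove e f).symm

/-- Equivalent linkoid diagrams have equivalent virtual closures. -/
lemma LinkoidDiagram.Equivalent.virtualClosure (hσ : IsClosurePerm σ) {L L' : LinkoidDiagram n τ}
    (hL : L.Equivalent L') {D D' : VirtualLinkDiagram} (h : IsVirtualClosure σ L D)
    (h' : IsVirtualClosure σ L' D') : D.Equivalent D' := by
  induction hL generalizing D D' with
  | rel L L' hmove =>
    rcases hmove with ⟨hm, hend⟩ | ⟨i, c, hp⟩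
    · exact equivalent_of_classicalMove hσ hm hend h h'
    · exact h.equivalent hσ (hp.isVirtualClosure hσ h')
  | refl L => exact h.equivalent hσ h'
  | symm L L' _ ih => exact (ih h' h).symm _ _
  | trans L₁ L₂ L₃ _ _ ih ih' =>
    obtain ⟨D₂, h₂⟩ := exists_isVirtualClosure hσ L₂
    exact (ih h h₂).trans _ _ _ (ih' h₂ h')

end

theorem theorem4p1 {n : ℕ} (τ σ : Equiv.Perm (Fin (2 * n))) (hσ : IsClosurePerm σ)
    {α : Type*} (F : VirtualLink → α) :
    (∀ L : LinkoidDiagram n τ, ∃ D, IsVirtualClosure σ L D) ∧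
    (∀ (L : LinkoidDiagram n τ) (D D' : VirtualLinkDiagram),
      IsVirtualClosure σ L D → IsVirtualClosure σ L D' → D.Equivalent D') ∧
    (∀ (L L' : LinkoidDiagram n τ) (D D' : VirtualLinkDiagram), L.Equivalent L' →
      IsVirtualClosure σ L D → IsVirtualClosure σ L' D' → D.Equivalent D') ∧
    (∃! Fσ : Linkoid n τ → α, ∀ (L : LinkoidDiagram n τ) (D : VirtualLinkDiagram),
      IsVirtualClosure σ L D → Fσ L.toLinkoid = F D.toVirtualLink) := by
  have hex := exists_isVirtualClosure (τ := τ) hσ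
  refine ⟨hex, fun _ _ _ h h' => h.equivalent hσ h', fun _ _ _ _ hL => hL.virtualClosure hσ, ?_⟩
  choose C hC using hex
  refine ⟨Quot.lift (fun L => F (C L).toVirtualLink) fun L L' hm => ?_, fun L D h => ?_, ?_⟩
  · exact congrArg F (Quot.eqvGen_sound
      (LinkoidDiagram.Equivalent.virtualClosure hσ (Relation.EqvGen.rel _ _ hm) (hC L) (hC L')))
  · exact congrArg F (Quot.eqvGen_sound ((hC L).equivalent hσ h))
  · intro G hG
    funext x
    induction x using Quot.ind with
    | _ L => exact hG L (C L) (hC L)
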